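/- Throughout, let $h>0$ and let $\beta:\mathbb{R}^+\to\mathbb{R}^+$ be a convex function with $\beta=0$ on $[0,h]$ and $\beta$ strictly increasing on $[h,\infty)$; $\beta^{-1}:[0,\infty)\to[h,\infty)$ denotes the inverse of the restriction of $\beta$ to $[h,\infty)$. Let $\mu$ be a Borel probability measure on $\mathbb{R}$. **Notation.** For a cost $\alpha:\mathbb{R}^+\to\mathbb{R}^+$ put $\mathcal{T}_\alpha(\nu,\mu)=\inf_\pi\iint\alpha(|x-y|)\,\pi(dx\,dy)$, the infimum being over all couplings $\pi$ of $\mu$ and $\nu$. For $a>0$, $\mu$ satisfies $\mathbf{T}_\beta(a)$ if $\mathcal{T}_{\beta(a\,\cdot)}(\nu,\mu)\le \mathbf{H}(\nu\mid\mu)$ for every Borel probability measure $\nu$ on $\mathbb{R}$, where $\mathbf{H}(\nu\mid\mu)$ is the relative entropy of $\nu$ with respect to $\mu$. For a probability measure $\nu$ on $\mathbb{R}$, $F_\nu(x)=\nu(-\infty,x]$ and $F_\nu^{-1}(u)=\inf\{x\in\mathbb{R}:F_\nu(x)\ge u\}\in\mathbb{R}\cup\{\pm\infty\}$ for $u\in[0,1]$.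 Let $\mu_1(dx)=\tfrac12e^{-|x|}dx$ and $$T=T_{\mu_1,\mu}=F_\mu^{-1}\circ F_{\mu_1},\qquad S(x,u)=F_{\mu_1}^{-1}\big(\mu(-\infty,x)+\mu(\{x\})u\big)\quad(x\in\mathbb{R},\ u\in[0,1]).$$ Let $s_\mu=\inf\operatorname{Supp}(\mu)$, $t_\mu=\sup\operatorname{Supp}(\mu)$, $m=F_\mu^{-1}(1/2)$, and, for $X$ of law $\mu$, let $\mu_x^+=\mathcal{L}(X-x\mid X>x)$ for $x<t_\mu$ and $\mu_x^-=\mathcal{L}(x-X\mid X<x)$ for $x>s_\mu$. For $b\ge0$ let $$K^+(b)=\sup_{m\le x<t_\mu}\int_0^\infty e^{\beta(bu)}\,\mu_x^+(du),\qquad K^-(b)=\sup_{s_\mu<x\le m}\int_0^\infty e^{\beta(bu)}\,\mu_x^-(du),$$ with values in $[0,\infty]$ and $\sup\emptyset=0$. **Theorem 2.4.** Suppose that $\mu$ is not a Dirac mass. The following are equivalent. 1. There is $a>0$ such that $\mu$ satisfies $\mathbf{T}_\beta(a)$. 2. There are $b>0$ and $K>0$ such that $\max(K^-(b);K^+(b))\le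 K$. 3. There is $c>0$ such that $|S(x,u)-S(y,v)|\ge\beta(c|x-y|)$ for all $x,y\in\mathbb{R}$ and $u,v\in[0,1]$ for which $S(x,u)$ and $S(y,v)$ are not both $+\infty$ and not both $-\infty$ (the left-hand side being $+\infty$ if exactly one of the two values is infinite or if they are opposite infinities). 4. There is $d>0$ such that $|T(u)-T(v)|\le\frac1d\beta^{-1}(|u-v|)$ for all real $u\ne v$. The constants are related as follows: (1) with $a$ implies (2) with $b=a/2$ and $K=3$; (2) with $b,K$ implies (3) with $c=b\,\frac{h}{4\beta^{-1}(\log K)}$; (3) with $c$ implies (4) with $d=c$; (4) with $d$ implies (1) with $a=d\,\frac{h}{9\beta^{-1}(2)}$. **Theorem 2.1.** For every Borel probability measure $\mu$ on $\mathbb{R}$, there is $a>0$ such that $\mu$ satisfies $\mathbf{T}_\beta(a)$ if and only if there is $d>0$ such that $|T(u)-T(v)|\le\frac1d\beta^{-1}(|u-v|)$ for all real $u\ne v$. Moreover, the optimal constants $a_{\rm opt},d_{\rm opt}\in[0,\infty]$ (the suprema of the admissible $a>0$, respectively $d>0$, with $\sup\emptyset=0$) satisfy $$d_{\rm opt}\left(\frac{h}{9\beta^{-1}(2)}\right)\le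 a_{\rm opt}\le d_{\rm opt}\left(\frac{8\beta^{-1}(\log 3)}{h}\right).$$ -/

import Mathlib

open MeasureTheory ProbabilityTheory Set
open scoped ENNReal

noncomputable section

namespace TransportLine

/-- The optimal transport cost between `ν` and `μ` for the cost function `α`:
the infimum of `∬ α(|x - y|) π(dx dy)` over all couplings `π` of `μ` and `ν`. -/
def transportCost (α : ℝ → ℝ) (ν μ : Measure ℝ) : ℝ≥0∞ :=
  ⨅ (π : Measure (ℝ × ℝ)) (_ : π.map Prod.fst = μ) (_ : π.map Prod.snd = ν),
    ∫⁻ p, ENNReal.ofReal (α |p.1 - p.2|) ∂π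

/-- The transport-entropy inequality `T_α(a)` for `μ`: the cost `t ↦ α(a t)` is dominated by the
relative entropy `H(ν | μ)`, for all Borel probability measures `ν`. -/
def TransportEntropy (α : ℝ → ℝ) (a : ℝ) (μ : Measure ℝ) : Prop :=
  ∀ ν : Measure ℝ, IsProbabilityMeasure ν →
    transportCost (fun t => α (a * t)) ν μ ≤ InformationTheory.klDiv ν μ

/-- The generalized inverse `F_ν⁻¹(u) = inf {x ∈ ℝ : F_ν(x) ≥ u}`, with values in `ℝ ∪ {±∞}`. -/
def quantile (ν : Measure ℝ) (u : ℝ) : EReal :=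
  ⨅ (x : ℝ) (_ : u ≤ cdf ν x), (x : EReal)

/-- The two-sided exponential distribution `μ₁(dx) = e^{-|x|} dx / 2`. -/
def expTwoSided : Measure ℝ :=
  volume.withDensity (fun x => ENNReal.ofReal (Real.exp (-|x|) / 2))

/-- The map `T_{μ,ν} = F_ν⁻¹ ∘ F_μ`. -/
def transportMap (μ ν : Measure ℝ) (x : ℝ) : EReal :=
  quantile ν (cdf μ x)

/-- The map `S_{μ,ν}(x,u) = F_ν⁻¹(μ(-∞,x) + μ({x}) u)`. -/
def transportPlanMap (μ ν : Measure ℝ) (x u : ℝ) : EReal :=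
  quantile ν (μ.real (Iio x) + μ.real {x} * u)

/-- `s_μ = inf Supp(μ)`. -/
def suppInf (μ : Measure ℝ) : EReal := ⨅ x ∈ μ.support, (x : EReal)

/-- `t_μ = sup Supp(μ)`. -/
def suppSup (μ : Measure ℝ) : EReal := ⨆ x ∈ μ.support, (x : EReal)

/-- `μ_x⁺`, the law of `X - x` given `X > x`, where `X` has law `μ`. -/
def upperTail (μ : Measure ℝ) (x : ℝ) : Measure ℝ :=
  (cond μ (Ioi x)).map (fun u => u - x)

/-- `μ_x⁻`, the law of `x - X` given `X < x`, where `X` has law `μ`. -/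
def lowerTail (μ : Measure ℝ) (x : ℝ) : Measure ℝ :=
  (cond μ (Iio x)).map (fun u => x - u)

/-- `K⁺(b) = sup_{m ≤ x < t_μ} ∫₀^∞ e^{β(bu)} μ_x⁺(du)` with `m = F_μ⁻¹(1/2)`
(and `sup ∅ = 0`). -/
def upperMoment (β : ℝ → ℝ) (μ : Measure ℝ) (b : ℝ) : ℝ≥0∞ :=
  ⨆ (x : ℝ) (_ : quantile μ (1 / 2) ≤ (x : EReal)) (_ : (x : EReal) < suppSup μ),
    ∫⁻ u in Ici 0, ENNReal.ofReal (Real.exp (β (b * u))) ∂(upperTail μ x)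

/-- `K⁻(b) = sup_{s_μ < x ≤ m} ∫₀^∞ e^{β(bu)} μ_x⁻(du)` with `m = F_μ⁻¹(1/2)`
(and `sup ∅ = 0`). -/
def lowerMoment (β : ℝ → ℝ) (μ : Measure ℝ) (b : ℝ) : ℝ≥0∞ :=
  ⨆ (x : ℝ) (_ : suppInf μ < (x : EReal)) (_ : (x : EReal) ≤ quantile μ (1 / 2)),
    ∫⁻ u in Ici 0, ENNReal.ofReal (Real.exp (β (b * u))) ∂(lowerTail μ x)

/-- `β⁻¹`, the inverse of the restriction of `β` to `[h, ∞)`. When `β` is convex on `[0, ∞)`,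
vanishes on `[0, h]` and is increasing on `[h, ∞)`, this restriction is a bijection from `[h, ∞)`
onto `[0, ∞)`; in particular `β⁻¹(0) = h`. -/
def rightInv (β : ℝ → ℝ) (h : ℝ) : ℝ → ℝ := Function.invFunOn β (Ici h)

/-- `|S(x,u) - S(y,v)| ≥ β(c|x - y|)` for all `x, y ∈ ℝ` and `u, v ∈ [0,1]`, where `S = S_{μ,μ₁}`.
The difference of two equal infinite values is undefined, and such pairs are left out; if exactly
one of the values is infinite, or if they are opposite infinities, the left-hand side is `∞`. -/
def PlanExpansion (β : ℝ → ℝ) (c : ℝ) (μ : Measure ℝ) : Prop :=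
  ∀ x y : ℝ, ∀ u ∈ Icc (0 : ℝ) 1, ∀ v ∈ Icc (0 : ℝ) 1,
    ¬ (transportPlanMap μ expTwoSided x u = ⊤ ∧ transportPlanMap μ expTwoSided y v = ⊤) →
    ¬ (transportPlanMap μ expTwoSided x u = ⊥ ∧ transportPlanMap μ expTwoSided y v = ⊥) →
    ENNReal.ofReal (β (c * |x - y|)) ≤
      (transportPlanMap μ expTwoSided x u - transportPlanMap μ expTwoSided y v).abs

/-- `|T(u) - T(v)| ≤ β⁻¹(|u - v|) / d` for all real `u ≠ v`, where `T = T_{μ₁,μ}`. -/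
def MapContraction (β : ℝ → ℝ) (h d : ℝ) (μ : Measure ℝ) : Prop :=
  ∀ u v : ℝ, u ≠ v →
    (transportMap expTwoSided μ u - transportMap expTwoSided μ v).abs ≤
      ENNReal.ofReal (1 / d * rightInv β h |u - v|)

/-- The optimal constant `a_opt ∈ [0, ∞]` in the transport-entropy inequality. -/
def optTransport (β : ℝ → ℝ) (μ : Measure ℝ) : ℝ≥0∞ :=
  ⨆ (a : ℝ) (_ : 0 < a) (_ : TransportEntropy β a μ), ENNReal.ofReal a

/-- The optimal constant `d_opt ∈ [0, ∞]` in the contraction property. -/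
def optContraction (β : ℝ → ℝ) (h : ℝ) (μ : Measure ℝ) : ℝ≥0∞ :=
  ⨆ (d : ℝ) (_ : 0 < d) (_ : MapContraction β h d μ), ENNReal.ofReal d

end TransportLine

end

open TransportLine

/-! The four conditions are linked in a cycle.

Transport-entropy to exponential moments. Let `ρ` be the distance to a half-line `s`. Comparing `μ`
with its conditioning on `s` and with its tilt by a truncation of `2 β(a ρ / 2)`, and joining the
two transport costs by convexity of `β`, gives `∫ exp(2 β(a ρ / 2)) dμ ≤ 1 / μ(s)`. If `s` has mass
at least 1/2, conditioning on its complement gives the bound 3.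

Moments to expansion of `S`. Markov's inequality for the conditional tails bounds `μ[y, ∞) / μ(x,
∞)` by `K exp(-β(b(y - x)))` beyond the median. Quantiles of the exponential law are logarithms of
tails, so this becomes a lower bound for differences of `S`. Superadditivity of `β` absorbs `log K`,
and a gap straddling the median loses a factor 2.

Expansion of `S` to contraction of `T`. The map `S` inverts `T` once the atoms of `μ` are spread out
by the variable in `[0, 1]`.

Contraction of `T` to transport-entropy. The core is the inequality for the exponential law itself
with the cost `(|x - y| - 6)⁺ / 6` (`lintegral_monotone_cost_le`). For a monotone map the cost is an
integral of positive parts of differences of distribution functions. This is bounded by entropy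
through the variational formula, tested on a function with slope 1/3 where the difference is
positive and 0 elsewhere (`lintegral_expCdf_sub_le`). A general `ν ≪ μ` lifts along `T` to a law of
the same entropy, and the lifted coupling is pushed back by `T`, whose modulus turns one cost into
the other. -/

namespace TransportLine

open InformationTheory

/-- A convex cost profile which vanishes exactly on `[0, h]`. -/
structure IsCost (β : ℝ → ℝ) (h : ℝ) : Prop where
  pos : 0 < h
  convex : ConvexOn ℝ (Ici 0) β
  zero : ∀ t ∈ Icc 0 h, β t = 0
  strictMono : StrictMonoOn β (Ici h)

/-! ### Convex cost profiles: superadditivity and the inverse. -/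

namespace IsCost

variable {β : ℝ → ℝ} {h : ℝ} (hβ : IsCost β h)
include hβ

theorem map_zero : β 0 = 0 := hβ.zero 0 ⟨le_rfl, hβ.pos.le⟩

theorem monotoneOn : MonotoneOn β (Ici 0) := by
  intro s hs t ht hst
  rcases le_total t h with h1 | h1
  · rw [hβ.zero s ⟨hs, hst.trans h1⟩, hβ.zero t ⟨ht, h1⟩]
  · rcases le_total s h with h2 | h2
    · rw [hβ.zero s ⟨hs, h2⟩, ← hβ.zero h ⟨hβ.pos.le, le_rfl⟩]
      exact hβ.strictMono.monotoneOn (mem_Ici.2 le_rfl) h1 h1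
    · exact hβ.strictMono.monotoneOn h2 h1 hst

theorem mono {s t : ℝ} (hs : 0 ≤ s) (hst : s ≤ t) : β s ≤ β t :=
  hβ.monotoneOn hs (hs.trans hst) hst

theorem nonneg {t : ℝ} (ht : 0 ≤ t) : 0 ≤ β t := by
  rw [← hβ.map_zero]; exact hβ.mono le_rfl ht

theorem map_mul_le {κ t : ℝ} (h0 : 0 ≤ κ) (h1 : κ ≤ 1) (ht : 0 ≤ t) : β (κ * t) ≤ κ * β t := by
  have := hβ.convex.2 (mem_Ici.2 ht) (mem_Ici.2 le_rfl) h0 (sub_nonneg.2 h1) (by ring)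
  simpa [hβ.map_zero] using this

/-- Convexity and `β 0 = 0` make `β t / t` nondecreasing. Superadditivity is what later absorbs
additive constants such as `log K` into the argument of `β`. -/
theorem add_le {s t : ℝ} (hs : 0 ≤ s) (ht : 0 ≤ t) : β s + β t ≤ β (s + t) := by
  rcases (add_nonneg hs ht).eq_or_lt with h0 | h0
  · have h1 : s = 0 := by linarith
    have h2 : t = 0 := by linarith
    simp [h1, h2, hβ.map_zero]
  · have h1 := hβ.map_mul_le (κ := s / (s + t)) (by positivity)
      ((div_le_one h0).2 (by linarith)) h0.le
    have h2 := hβ.map_mul_le (κ := t / (s + t)) (by positivity)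
      ((div_le_one h0).2 (by linarith)) h0.le
    rw [div_mul_cancel₀ _ h0.ne'] at h1 h2
    have : s / (s + t) * β (s + t) + t / (s + t) * β (s + t) = β (s + t) := by
      field_simp
    linarith

theorem natCast_mul_le (n : ℕ) {t : ℝ} (ht : 0 ≤ t) : n * β t ≤ β (n * t) := by
  induction n with
  | zero => simp [hβ.map_zero]
  | succ n ih =>
    have := hβ.add_le (mul_nonneg n.cast_nonneg ht) ht
    push_cast
    rw [add_mul, add_mul, one_mul, one_mul]
    linarith

theorem continuousOn : ContinuousOn β (Ioi 0) :=
  (hβ.convex.subset Ioi_subset_Ici_self (convex_Ioi 0)).continuousOn isOpen_Ioi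

theorem exists_eq {y : ℝ} (hy : 0 ≤ y) : ∃ t ∈ Ici h, β t = y := by
  have h0 := hβ.pos
  -- A single positive value suffices: superadditivity makes `β` grow at least linearly along the
  -- multiples of `2 * h`, hence unbounded.
  have hpos : 0 < β (2 * h) := by
    rw [← hβ.zero h ⟨h0.le, le_rfl⟩]
    exact hβ.strictMono (mem_Ici.2 le_rfl) (mem_Ici.2 (by linarith)) (by linarith)
  obtain ⟨n, hn⟩ := exists_nat_gt (y / β (2 * h))
  rw [div_lt_iff₀ hpos] at hn
  have hn' := hn.le.trans (hβ.natCast_mul_le n (by linarith : 0 ≤ 2 * h))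
  have hle : h ≤ n * (2 * h) := by
    have hn1 : (1 : ℝ) ≤ n := by
      rcases Nat.eq_zero_or_pos n with rfl | h1
      · simp at hn; linarith
      · exact_mod_cast h1
    nlinarith
  have := intermediate_value_Icc hle
    (hβ.continuousOn.mono fun t ht => mem_Ioi.2 (h0.trans_le ht.1))
  obtain ⟨t, ht, rfl⟩ := this ⟨by rwa [hβ.zero h ⟨h0.le, le_rfl⟩], hn'⟩
  exact ⟨t, ht.1, rfl⟩

theorem le_rightInv {y : ℝ} (hy : 0 ≤ y) : h ≤ rightInv β h y :=
  Function.invFunOn_mem (hβ.exists_eq hy)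

theorem map_rightInv {y : ℝ} (hy : 0 ≤ y) : β (rightInv β h y) = y :=
  Function.invFunOn_eq (hβ.exists_eq hy)

theorem rightInv_pos {y : ℝ} (hy : 0 ≤ y) : 0 < rightInv β h y :=
  hβ.pos.trans_le (hβ.le_rightInv hy)

theorem le_rightInv_of_le {s y : ℝ} (hy : 0 ≤ y) (hs : β s ≤ y) : s ≤ rightInv β h y := by
  by_contra! H
  have h1 := hβ.le_rightInv hy
  have := hβ.strictMono (mem_Ici.2 h1) (mem_Ici.2 (h1.trans H.le)) H
  rw [hβ.map_rightInv hy] at this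
  linarith

/-- Nothing is known about `β` on negative numbers; truncating the argument gives a function
monotone on the whole line, hence measurable. -/
theorem monotone_extend : Monotone fun t => β (max t 0) := fun _ _ hst =>
  hβ.mono (le_max_right _ _) (max_le_max_right 0 hst)

theorem measurable_comp {α : Type*} [MeasurableSpace α] {f : α → ℝ} (hf : Measurable f)
    (hf0 : ∀ x, 0 ≤ f x) : Measurable fun x => β (f x) := by
  convert hβ.monotone_extend.measurable.comp hf using 2 with x
  simp [hf0 x]

end IsCost

/-! ### Quantile functions. -/

theorem quantile_le (ν : Measure ℝ) {p x : ℝ} (hx : p ≤ cdf ν x) : quantile ν p ≤ x :=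
  iInf₂_le (f := fun (x : ℝ) (_ : p ≤ cdf ν x) => (x : EReal)) x hx

/-- Right continuity of the distribution function makes the infimum a minimum, whence the Galois
connection on which later uses of quantiles rest. -/
theorem exists_quantile_eq (ν : Measure ℝ) [IsProbabilityMeasure ν] {p : ℝ} (h0 : 0 < p)
    (h1 : p < 1) : ∃ x₀ : ℝ, quantile ν p = x₀ ∧ ∀ x : ℝ, x₀ ≤ x ↔ p ≤ cdf ν x := by
  set s : Set ℝ := {x | p ≤ cdf ν x}
  have hne : s.Nonempty := by
    obtain ⟨x, hx⟩ := ((tendsto_cdf_atTop ν).eventually (eventually_ge_nhds h1)).exists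
    exact ⟨x, hx⟩
  have hbdd : BddBelow s := by
    obtain ⟨x, hx⟩ := ((tendsto_cdf_atBot ν).eventually (eventually_lt_nhds h0)).exists
    refine ⟨x, fun y hy => ?_⟩
    by_contra! H
    exact absurd (hy.trans (monotone_cdf ν H.le)) (not_le.2 hx)
  have hmem : p ≤ cdf ν (sInf s) := by
    have ht : Filter.Tendsto (cdf ν) (nhdsWithin (sInf s) (Ioi (sInf s))) (nhds (cdf ν (sInf s))) :=
      ((cdf ν).right_continuous (sInf s)).tendsto.mono_left (nhdsWithin_mono _ Ioi_subset_Ici_self)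
    refine ge_of_tendsto ht ?_
    filter_upwards [self_mem_nhdsWithin] with x hx
    obtain ⟨y, hy, hyx⟩ := exists_lt_of_csInf_lt hne hx
    exact le_trans hy (monotone_cdf ν hyx.le)
  have key : ∀ x : ℝ, sInf s ≤ x ↔ p ≤ cdf ν x :=
    fun x => ⟨fun hx => hmem.trans (monotone_cdf ν hx), fun hx => csInf_le hbdd hx⟩
  refine ⟨sInf s, le_antisymm (quantile_le ν hmem) (le_iInf₂ fun x hx => ?_), key⟩
  exact_mod_cast (key x).2 hx

theorem quantile_of_nonpos (ν : Measure ℝ) {p : ℝ} (hp : p ≤ 0) : quantile ν p = ⊥ := by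
  rw [EReal.eq_bot_iff_forall_lt]
  intro y
  refine lt_of_le_of_lt (quantile_le ν (x := y - 1) (hp.trans (cdf_nonneg ν _))) ?_
  exact_mod_cast sub_one_lt y

theorem quantile_of_forall_lt (ν : Measure ℝ) {p : ℝ} (hp : ∀ x, cdf ν x < p) :
    quantile ν p = ⊤ := by
  rw [eq_top_iff]
  exact le_iInf₂ fun x hx => absurd hx (not_le.2 (hp x))

/-! ### The two-sided exponential law. -/

/-- The distribution function of the two-sided exponential distribution. -/
noncomputable def expCdf (x : ℝ) : ℝ :=
  if x ≤ 0 then Real.exp x / 2 else 1 - Real.exp (-x) / 2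

theorem expCdf_of_nonpos {x : ℝ} (hx : x ≤ 0) : expCdf x = Real.exp x / 2 := if_pos hx

theorem expCdf_of_nonneg {x : ℝ} (hx : 0 ≤ x) : expCdf x = 1 - Real.exp (-x) / 2 := by
  rcases hx.eq_or_lt with rfl | h
  · norm_num [expCdf]
  · exact if_neg (not_le.2 h)

theorem expCdf_neg (x : ℝ) : expCdf (-x) = 1 - expCdf x := by
  rcases le_total x 0 with h | h
  · rw [expCdf_of_nonneg (neg_nonneg.2 h), expCdf_of_nonpos h, neg_neg]
  · rw [expCdf_of_nonpos (neg_nonpos.2 h), expCdf_of_nonneg h]; ring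

theorem expTwoSided_Iic {x : ℝ} (hx : x ≤ 0) :
    expTwoSided (Iic x) = ENNReal.ofReal (Real.exp x / 2) := by
  rw [expTwoSided, withDensity_apply _ measurableSet_Iic,
    setLIntegral_congr_fun (g := fun t => ENNReal.ofReal (Real.exp t / 2)) measurableSet_Iic
      (fun t ht => by simp only [abs_of_nonpos (le_trans ht hx), neg_neg]),
    ← ofReal_integral_eq_lintegral_ofReal ((integrableOn_exp_Iic x).div_const 2)
      (Filter.Eventually.of_forall fun t => by positivity),
    integral_div, integral_exp_Iic]

theorem expTwoSided_map_neg : expTwoSided.map (fun x : ℝ => -x) = expTwoSided := by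
  ext s hs
  rw [Measure.map_apply measurable_neg hs, expTwoSided, withDensity_apply _ hs,
    withDensity_apply _ (measurable_neg hs),
    ← (Measure.measurePreserving_neg (volume : Measure ℝ)).setLIntegral_comp_preimage hs (by fun_prop)]
  simp

theorem expTwoSided_Ici {x : ℝ} (hx : 0 ≤ x) :
    expTwoSided (Ici x) = ENNReal.ofReal (Real.exp (-x) / 2) := by
  rw [← expTwoSided_Iic (neg_nonpos.2 hx)]
  nth_rewrite 1 [← expTwoSided_map_neg]
  rw [Measure.map_apply measurable_neg measurableSet_Ici]
  congr 1
  ext y; simp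

theorem expTwoSided_singleton (x : ℝ) : expTwoSided {x} = 0 :=
  withDensity_absolutelyContinuous _ _ (by simp)

theorem expTwoSided_Ioi {x : ℝ} (hx : 0 ≤ x) :
    expTwoSided (Ioi x) = ENNReal.ofReal (Real.exp (-x) / 2) := by
  rw [← expTwoSided_Ici hx]
  refine le_antisymm (measure_mono Ioi_subset_Ici_self) ?_
  rw [← Ioi_union_left]
  refine (measure_union_le _ _).trans ?_
  rw [expTwoSided_singleton, add_zero]

instance : IsProbabilityMeasure expTwoSided where
  measure_univ := by
    rw [← Iic_union_Ioi (a := (0 : ℝ)), measure_union (Iic_disjoint_Ioi le_rfl) measurableSet_Ioi,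
      expTwoSided_Iic le_rfl, expTwoSided_Ioi le_rfl, ← ENNReal.ofReal_add (by positivity)
      (by positivity)]
    norm_num

theorem expTwoSided_real_Iic (x : ℝ) : expTwoSided.real (Iic x) = expCdf x := by
  rcases le_total x 0 with h | h
  · rw [expCdf_of_nonpos h, measureReal_def, expTwoSided_Iic h,
      ENNReal.toReal_ofReal (by positivity)]
  · rw [← compl_Ioi, probReal_compl_eq_one_sub measurableSet_Ioi, expCdf_of_nonneg h,
      measureReal_def, expTwoSided_Ioi h, ENNReal.toReal_ofReal (by positivity)]

theorem cdf_expTwoSided (x : ℝ) : cdf expTwoSided x = expCdf x := by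
  rw [cdf_eq_real, expTwoSided_real_Iic]

theorem expCdf_strictMono : StrictMono expCdf := by
  intro x y hxy
  have e1 := Real.exp_pos x
  have e2 := Real.exp_pos (-y)
  rcases le_total y 0 with h | h
  · rw [expCdf_of_nonpos h, expCdf_of_nonpos (hxy.le.trans h)]
    have := Real.exp_lt_exp.2 hxy
    linarith
  · rw [expCdf_of_nonneg h]
    rcases le_total x 0 with h' | h'
    · rw [expCdf_of_nonpos h']
      have h1 := Real.exp_le_one_iff.2 h'
      have h2 := Real.exp_le_one_iff.2 (neg_nonpos.2 h)
      rcases h'.eq_or_lt with rfl | h3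
      · have := Real.exp_lt_one_iff.2 (neg_lt_zero.2 hxy)
        linarith
      · have := Real.exp_lt_one_iff.2 h3
        linarith
    · rw [expCdf_of_nonneg h']
      have := Real.exp_lt_exp.2 (neg_lt_neg hxy)
      linarith

theorem expCdf_pos (x : ℝ) : 0 < expCdf x := by
  rcases le_total x 0 with h | h
  · rw [expCdf_of_nonpos h]; positivity
  · rw [expCdf_of_nonneg h]
    have := Real.exp_le_one_iff.2 (neg_nonpos.2 h)
    linarith

theorem expCdf_lt_one (x : ℝ) : expCdf x < 1 := by
  have := expCdf_pos (-x)
  rw [expCdf_neg] at this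
  linarith

theorem quantile_expCdf (x : ℝ) : quantile expTwoSided (expCdf x) = x := by
  obtain ⟨y, hy, hy'⟩ := exists_quantile_eq expTwoSided (expCdf_pos x) (expCdf_lt_one x)
  rw [hy]
  have h1 : y ≤ x := (hy' x).2 (cdf_expTwoSided x).ge
  have h2 := (hy' y).1 le_rfl
  rw [cdf_expTwoSided, expCdf_strictMono.le_iff_le] at h2
  rw [le_antisymm h1 h2]

/-- The inverse of the distribution function of the two-sided exponential distribution. -/
noncomputable def expQuantile (p : ℝ) : ℝ :=
  if p ≤ 1 / 2 then Real.log (2 * p) else -Real.log (2 * (1 - p))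

theorem expQuantile_of_le {p : ℝ} (hp : p ≤ 1 / 2) : expQuantile p = Real.log (2 * p) := if_pos hp

theorem expQuantile_of_ge {p : ℝ} (hp : 1 / 2 ≤ p) :
    expQuantile p = -Real.log (2 * (1 - p)) := by
  rcases hp.eq_or_lt with rfl | h
  · norm_num [expQuantile]
  · exact if_neg (not_le.2 h)

theorem expCdf_expQuantile {p : ℝ} (h0 : 0 < p) (h1 : p < 1) : expCdf (expQuantile p) = p := by
  rcases le_total p (1 / 2) with h | h
  · rw [expQuantile_of_le h, expCdf_of_nonpos (Real.log_nonpos (by linarith) (by linarith)),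
      Real.exp_log (by linarith)]
    ring
  · rw [expQuantile_of_ge h, expCdf_of_nonneg
      (neg_nonneg.2 (Real.log_nonpos (by linarith) (by linarith))), neg_neg,
      Real.exp_log (by linarith)]
    ring

theorem expQuantile_mono {p q : ℝ} (h0 : 0 < p) (hpq : p ≤ q) (h1 : q < 1) :
    expQuantile p ≤ expQuantile q := by
  rw [← expCdf_strictMono.le_iff_le, expCdf_expQuantile h0 (hpq.trans_lt h1),
    expCdf_expQuantile (h0.trans_le hpq) h1]
  exact hpq

theorem quantile_expTwoSided {p : ℝ} (h0 : 0 < p) (h1 : p < 1) :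
    quantile expTwoSided p = expQuantile p := by
  nth_rewrite 1 [← expCdf_expQuantile h0 h1]
  exact quantile_expCdf _

theorem quantile_expTwoSided_of_ge {p : ℝ} (h1 : 1 ≤ p) : quantile expTwoSided p = ⊤ :=
  quantile_of_forall_lt _ fun x => by
    rw [cdf_expTwoSided]; exact (expCdf_lt_one x).trans_le h1

/-! ### Relative entropy of conditioned and tilted measures. -/

theorem klDiv_cond {α : Type*} [MeasurableSpace α] (μ : Measure α) [IsProbabilityMeasure μ]
    {s : Set α} (hs : MeasurableSet s) (h0 : μ s ≠ 0) :
    klDiv (cond μ s) μ = ENNReal.ofReal (-Real.log (μ.real s)) := by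
  have hp : IsProbabilityMeasure (cond μ s) := cond_isProbabilityMeasure h0
  have hac : cond μ s ≪ μ := cond_absolutelyContinuous
  have hllr : llr (cond μ s) μ =ᵐ[cond μ s] fun _ => -Real.log (μ.real s) := by
    have h1 : (cond μ s).rnDeriv μ =ᵐ[cond μ s] (μ s)⁻¹ • (μ.restrict s).rnDeriv μ :=
      hac.ae_le (Measure.rnDeriv_smul_left_of_ne_top _ _ (ENNReal.inv_ne_top.2 h0))
    have h2 := hac.ae_le (Measure.rnDeriv_restrict_self μ hs)
    have h3 : ∀ᵐ x ∂(cond μ s), x ∈ s := by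
      rw [ae_iff, ← compl_def, cond_apply hs, inter_compl_self, measure_empty, mul_zero]
    filter_upwards [h1, h2, h3] with x h1 h2 h3
    rw [llr, h1, Pi.smul_apply, h2, indicator_of_mem h3]
    simp [measureReal_def, Real.log_inv]
  have hint : Integrable (llr (cond μ s) μ) (cond μ s) :=
    (integrable_const (-Real.log (μ.real s))).congr hllr.symm
  rw [← ENNReal.ofReal_toReal (klDiv_ne_top hac hint),
    toReal_klDiv_of_measure_eq hac (by simp), integral_congr_ae hllr]
  simp

theorem klDiv_tilted {α : Type*} [MeasurableSpace α] (μ : Measure α) [IsProbabilityMeasure μ]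
    {g : α → ℝ} (hg : Measurable g) {C : ℝ} (hC : ∀ x, |g x| ≤ C) :
    klDiv (μ.tilted g) μ ≠ ∞ ∧ (klDiv (μ.tilted g) μ).toReal =
      ∫ x, g x ∂(μ.tilted g) - Real.log (∫ x, Real.exp (g x) ∂μ) := by
  have hexp : Integrable (fun x => Real.exp (g x)) μ :=
    Integrable.of_bound hg.exp.aestronglyMeasurable (Real.exp C) (.of_forall fun x => by
      rw [Real.norm_of_nonneg (Real.exp_pos _).le]
      exact Real.exp_le_exp.2 ((le_abs_self _).trans (hC x)))
  have hp : IsProbabilityMeasure (μ.tilted g) := isProbabilityMeasure_tilted hexp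
  have hac : μ.tilted g ≪ μ := tilted_absolutelyContinuous μ g
  have hllr : llr (μ.tilted g) μ =ᵐ[μ.tilted g]
      fun x => g x - Real.log (∫ x, Real.exp (g x) ∂μ) :=
    hac.ae_le (log_rnDeriv_tilted_left_self hexp)
  have hgi : Integrable g (μ.tilted g) :=
    Integrable.of_bound hg.aestronglyMeasurable C (.of_forall hC)
  have hint : Integrable (llr (μ.tilted g) μ) (μ.tilted g) :=
    (hgi.sub (integrable_const _)).congr hllr.symm
  refine ⟨klDiv_ne_top hac hint, ?_⟩
  rw [toReal_klDiv_of_measure_eq hac (by simp), integral_congr_ae hllr, integral_sub hgi (integrable_const _)]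
  simp

/-! ### From the transport-entropy inequality to exponential moments. -/

variable {β : ℝ → ℝ} {h : ℝ}

theorem IsCost.two_mul_half_le (hβ : IsCost β h) {r s t : ℝ} (hr : 0 ≤ r) (hs : 0 ≤ s)
    (ht : 0 ≤ t) (hst : 2 * r ≤ s + t) : 2 * β r ≤ β s + β t := by
  have h1 := hβ.convex.2 (mem_Ici.2 hs) (mem_Ici.2 ht) (by norm_num : (0 : ℝ) ≤ 1 / 2)
    (by norm_num : (0 : ℝ) ≤ 1 / 2) (by norm_num)
  have h2 : β r ≤ β ((1 / 2 : ℝ) • s + (1 / 2 : ℝ) • t) :=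
    hβ.mono hr (by simp only [smul_eq_mul]; linarith)
  simp only [smul_eq_mul] at h1 h2
  linarith

/-- The exponential moment of the distance to a set, under a transport-entropy inequality. -/
theorem TransportEntropy.lintegral_exp_le (hβ : IsCost β h) {a : ℝ} (ha : 0 < a)
    {μ : Measure ℝ} [IsProbabilityMeasure μ] (hT : TransportEntropy β a μ)
    {ρ : ℝ → ℝ} (hρm : Measurable ρ) (hρ0 : ∀ x, 0 ≤ ρ x)
    (hρ : ∀ x y, ρ x ≤ ρ y + |x - y|) (h0 : μ {x | ρ x = 0} ≠ 0) :
    ∫⁻ x, ENNReal.ofReal (Real.exp (2 * β (a / 2 * ρ x))) ∂μ ≤ (μ {x | ρ x = 0})⁻¹ := by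
  set s : Set ℝ := {x | ρ x = 0} with hs_def
  have hs : MeasurableSet s := hρm (measurableSet_singleton 0)
  have hsr : 0 < μ.real s := ENNReal.toReal_pos h0 (measure_ne_top _ _)
  have hφm : Measurable fun z => ENNReal.ofReal (β (a * ρ z)) :=
    (hβ.measurable_comp (hρm.const_mul a) fun x => mul_nonneg ha.le (hρ0 x)).ennreal_ofReal
  have hGm : Measurable fun y => 2 * β (a / 2 * ρ y) :=
    (hβ.measurable_comp (hρm.const_mul (a / 2))
      fun x => mul_nonneg (by positivity) (hρ0 x)).const_mul 2
  have hG0 : ∀ y, 0 ≤ 2 * β (a / 2 * ρ y) := fun y =>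
    mul_nonneg zero_le_two (hβ.nonneg (mul_nonneg (by positivity) (hρ0 y)))
  -- transport from the conditional measure
  have h1 : ∫⁻ z, ENNReal.ofReal (β (a * ρ z)) ∂μ ≤ ENNReal.ofReal (-Real.log (μ.real s)) := by
    have hp : IsProbabilityMeasure (cond μ s) := cond_isProbabilityMeasure h0
    rw [← klDiv_cond μ hs h0]
    refine le_trans ?_ (hT (cond μ s) hp)
    refine le_iInf fun π => le_iInf fun hπ1 => le_iInf fun hπ2 => ?_
    have hmem : ∀ᵐ p ∂π, p.2 ∈ s := by
      have : ∀ᵐ x ∂(π.map Prod.snd), x ∈ s := by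
        rw [hπ2, ae_iff, ← compl_def, cond_apply hs, inter_compl_self, measure_empty, mul_zero]
      exact ae_of_ae_map measurable_snd.aemeasurable this
    rw [← hπ1]
    refine (lintegral_map_le _ _).trans (lintegral_mono_ae ?_)
    filter_upwards [hmem] with p hp
    refine ENNReal.ofReal_le_ofReal (hβ.mono (mul_nonneg ha.le (hρ0 _)) ?_)
    have := hρ p.1 p.2
    rw [show ρ p.2 = 0 from hp, zero_add] at this
    gcongr
  -- transport to the tilted measure
  have key : ∀ n : ℕ, ∫⁻ x, ENNReal.ofReal (Real.exp (min (2 * β (a / 2 * ρ x)) n)) ∂μ ≤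
      (μ s)⁻¹ := by
    intro n
    -- Truncation keeps the tilt well defined and its entropy finite; monotone convergence removes
    -- it at the end.
    set g : ℝ → ℝ := fun x => min (2 * β (a / 2 * ρ x)) n with hg
    have hgm : Measurable g := hGm.min measurable_const
    have hg0 : ∀ x, 0 ≤ g x := fun x => le_min (hG0 x) n.cast_nonneg
    have hgb : ∀ x, |g x| ≤ n := fun x => by
      rw [abs_of_nonneg (hg0 x)]; exact min_le_right _ _
    have hexp : Integrable (fun x => Real.exp (g x)) μ :=
      Integrable.of_bound hgm.exp.aestronglyMeasurable (Real.exp n) (.of_forall fun x => by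
        rw [Real.norm_of_nonneg (Real.exp_pos _).le]
        exact Real.exp_le_exp.2 (min_le_right _ _))
    have hp : IsProbabilityMeasure (μ.tilted g) := isProbabilityMeasure_tilted hexp
    have hgi : Integrable g (μ.tilted g) :=
      Integrable.of_bound hgm.aestronglyMeasurable n (.of_forall hgb)
    -- Under any coupling of `μ` with the tilt, `ρ y ≤ ρ x + |x - y|` and convexity give `2 β(a ρ(y)
    -- / 2) ≤ β(a ρ(x)) + β(a |x - y|)`. The first term is controlled by the entropy of the
    -- conditioned law, the second by that of the tilt.
    have h2 : ENNReal.ofReal (∫ x, g x ∂(μ.tilted g)) ≤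
        ENNReal.ofReal (-Real.log (μ.real s)) + klDiv (μ.tilted g) μ := by
      refine le_trans ?_ (add_le_add h1 (hT (μ.tilted g) hp))
      rw [transportCost, ENNReal.add_iInf]
      refine le_iInf fun π => ?_
      by_cases hπ1 : π.map Prod.fst = μ
      swap; · simp [hπ1]
      by_cases hπ2 : π.map Prod.snd = μ.tilted g
      swap; · simp [hπ2]
      simp only [hπ1, hπ2, iInf_pos]
      rw [ofReal_integral_eq_lintegral_ofReal hgi (.of_forall hg0), ← hπ2]
      have hφ : ∫⁻ z, ENNReal.ofReal (β (a * ρ z)) ∂μ =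
          ∫⁻ z, ENNReal.ofReal (β (a * ρ z)) ∂(π.map Prod.fst) := by rw [hπ1]
      have hφm' : Measurable fun p : ℝ × ℝ => ENNReal.ofReal (β (a * ρ p.1)) :=
        hφm.comp measurable_fst
      rw [hφ, lintegral_map hφm measurable_fst, ← lintegral_add_left hφm']
      refine (lintegral_map_le _ _).trans (lintegral_mono fun p => ?_)
      rw [← ENNReal.ofReal_add (hβ.nonneg (mul_nonneg ha.le (hρ0 _))) (hβ.nonneg (by positivity))]
      refine ENNReal.ofReal_le_ofReal ((min_le_left _ _).trans ?_)
      refine hβ.two_mul_half_le (mul_nonneg (by positivity) (hρ0 _))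
        (mul_nonneg ha.le (hρ0 _)) (by positivity) ?_
      have := hρ p.2 p.1
      rw [abs_sub_comm] at this
      nlinarith
    have hZ : (1 : ℝ) ≤ ∫ x, Real.exp (g x) ∂μ := by
      have := integral_mono (integrable_const (1 : ℝ)) hexp fun x => Real.one_le_exp (hg0 x)
      simpa using this
    have hs1 : Real.log (μ.real s) ≤ 0 := Real.log_nonpos hsr.le measureReal_le_one
    -- The entropy of the tilt is `∫ g` minus the logarithm of the normalising constant, so the
    -- finite term `∫ g` cancels from `h2`.
    have h3 : Real.log (∫ x, Real.exp (g x) ∂μ) ≤ -Real.log (μ.real s) := by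
      obtain ⟨hne, heq⟩ := klDiv_tilted μ hgm hgb
      have h5 : 0 ≤ (klDiv (μ.tilted g) μ).toReal := ENNReal.toReal_nonneg
      rw [← ENNReal.ofReal_toReal hne, ← ENNReal.ofReal_add (by linarith) h5,
        ENNReal.ofReal_le_ofReal_iff (by linarith), heq] at h2
      linarith
    rw [← ofReal_integral_eq_lintegral_ofReal hexp (.of_forall fun x => (Real.exp_pos _).le),
      ← ofReal_measureReal, ← ENNReal.ofReal_inv_of_pos hsr]
    refine ENNReal.ofReal_le_ofReal ?_
    rw [← Real.log_inv] at h3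
    exact (Real.log_le_log_iff (by linarith) (by positivity)).1 h3
  have hlim : Filter.Tendsto
      (fun n : ℕ => ∫⁻ x, ENNReal.ofReal (Real.exp (min (2 * β (a / 2 * ρ x)) n)) ∂μ)
      Filter.atTop (nhds (∫⁻ x, ENNReal.ofReal (Real.exp (2 * β (a / 2 * ρ x))) ∂μ)) := by
    refine lintegral_tendsto_of_tendsto_of_monotone
      (fun n => ((hGm.min measurable_const).exp.ennreal_ofReal).aemeasurable)
      (.of_forall fun x m n hmn => ?_) (.of_forall fun x => ?_)
    · refine ENNReal.ofReal_le_ofReal (Real.exp_le_exp.2 (min_le_min_left _ ?_))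
      exact_mod_cast hmn
    · refine tendsto_const_nhds.congr' ?_
      obtain ⟨N, hN⟩ := exists_nat_ge (2 * β (a / 2 * ρ x))
      filter_upwards [Filter.eventually_ge_atTop N] with n hn
      rw [min_eq_left (hN.trans (by exact_mod_cast hn))]
  exact le_of_tendsto' hlim key

/-- The exponential moment, given that `ρ` does not vanish, when `ρ` vanishes with probability at
least one half. -/
theorem TransportEntropy.lintegral_cond_le (hβ : IsCost β h) {a : ℝ} (ha : 0 < a)
    {μ : Measure ℝ} [IsProbabilityMeasure μ] (hT : TransportEntropy β a μ)
    {ρ : ℝ → ℝ} (hρm : Measurable ρ) (hρ0 : ∀ x, 0 ≤ ρ x)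
    (hρ : ∀ x y, ρ x ≤ ρ y + |x - y|) (h0 : μ {x | ρ x = 0}ᶜ ≠ 0)
    (h1 : 1 / 2 ≤ μ.real {x | ρ x = 0}) :
    ∫⁻ x, ENNReal.ofReal (Real.exp (β (a / 2 * ρ x))) ∂(cond μ {x | ρ x = 0}ᶜ) ≤ 3 := by
  set s : Set ℝ := {x | ρ x = 0} with hs_def
  have hs : MeasurableSet s := hρm (measurableSet_singleton 0)
  have hs0 : μ s ≠ 0 := fun H => by
    rw [measureReal_def, H] at h1; norm_num at h1
  set f : ℝ → ℝ≥0∞ := fun x => ENNReal.ofReal (Real.exp (2 * β (a / 2 * ρ x)))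
  have hmain : ∫⁻ x, f x ∂μ ≤ (μ s)⁻¹ := hT.lintegral_exp_le hβ ha hρm hρ0 hρ hs0
  have hle : ∫⁻ x, ENNReal.ofReal (Real.exp (β (a / 2 * ρ x))) ∂(cond μ sᶜ) ≤
      ∫⁻ x, f x ∂(cond μ sᶜ) := by
    refine lintegral_mono fun x => ENNReal.ofReal_le_ofReal (Real.exp_le_exp.2 ?_)
    have := hβ.nonneg (mul_nonneg (by positivity : 0 ≤ a / 2) (hρ0 x))
    linarith
  refine hle.trans ?_
  rw [ProbabilityTheory.cond, lintegral_smul_measure, smul_eq_mul]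
  rw [← lintegral_add_compl f hs, setLIntegral_congr_fun (g := fun _ => 1) hs
    (fun x hx => by simp [f, show ρ x = 0 from hx, hβ.map_zero]), lintegral_one,
    Measure.restrict_apply_univ] at hmain
  have hIt : ∫⁻ x in sᶜ, f x ∂μ ≠ ∞ :=
    ((le_add_self.trans hmain).trans_lt (ENNReal.inv_lt_top.2 (pos_iff_ne_zero.2 hs0))).ne
  have hq : μ.real sᶜ = 1 - μ.real s := probReal_compl_eq_one_sub hs
  have hq0 : 0 < μ.real sᶜ := ENNReal.toReal_pos h0 (measure_ne_top _ _)
  lift ∫⁻ x in sᶜ, f x ∂μ to NNReal using hIt with I hI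
  have hr := ENNReal.toReal_mono (ENNReal.inv_ne_top.2 hs0) hmain
  rw [ENNReal.toReal_add (measure_ne_top _ _) ENNReal.coe_ne_top, ENNReal.toReal_inv,
    ← measureReal_def, ENNReal.coe_toReal] at hr
  rw [ENNReal.inv_mul_le_iff h0 (measure_ne_top _ _), ← ofReal_measureReal,
    ← ENNReal.ofReal_coe_nnreal, show (3 : ℝ≥0∞) = ENNReal.ofReal 3 by simp,
    ← ENNReal.ofReal_mul hq0.le]
  refine ENNReal.ofReal_le_ofReal ?_
  rw [hq] at hq0 ⊢
  have hp : 0 < μ.real s := by linarith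
  -- With `p = μ.real s`, the claim `1 / p - p ≤ 3 (1 - p)` amounts to `(1 - p) (2 p - 1) ≥ 0`.
  refine (le_sub_iff_add_le'.2 hr).trans ?_
  rw [sub_le_iff_le_add, inv_le_iff_one_le_mul₀ hp]
  nlinarith

theorem lt_suppSup_iff {μ : Measure ℝ} [IsProbabilityMeasure μ] {x : ℝ} :
    (x : EReal) < suppSup μ ↔ μ (Ioi x) ≠ 0 := by
  simp only [suppSup, lt_iSup_iff, EReal.coe_lt_coe_iff]
  constructor
  · rintro ⟨y, hy, hxy⟩
    exact ((Measure.mem_support_iff_forall y).1 hy _ (Ioi_mem_nhds hxy)).ne'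
  · intro h0
    obtain ⟨y, hy, hy'⟩ := Measure.nonempty_inter_support_of_pos (pos_iff_ne_zero.2 h0)
    exact ⟨y, hy', hy⟩

theorem suppInf_lt_iff {μ : Measure ℝ} [IsProbabilityMeasure μ] {x : ℝ} :
    suppInf μ < (x : EReal) ↔ μ (Iio x) ≠ 0 := by
  simp only [suppInf, iInf_lt_iff, EReal.coe_lt_coe_iff]
  constructor
  · rintro ⟨y, hy, hxy⟩
    exact ((Measure.mem_support_iff_forall y).1 hy _ (Iio_mem_nhds hxy)).ne'
  · intro h0
    obtain ⟨y, hy, hy'⟩ := Measure.nonempty_inter_support_of_pos (pos_iff_ne_zero.2 h0)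
    exact ⟨y, hy', hy⟩

theorem quantile_half_le_iff {μ : Measure ℝ} [IsProbabilityMeasure μ] {x : ℝ} :
    quantile μ (1 / 2) ≤ x ↔ 1 / 2 ≤ μ.real (Iic x) := by
  obtain ⟨m, hm, hm'⟩ := exists_quantile_eq μ (p := 1 / 2) (by norm_num) (by norm_num)
  rw [hm, EReal.coe_le_coe_iff, hm', cdf_eq_real]

theorem half_le_of_le_quantile {μ : Measure ℝ} [IsProbabilityMeasure μ] {x : ℝ}
    (hx : (x : EReal) ≤ quantile μ (1 / 2)) : 1 / 2 ≤ μ.real (Ici x) := by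
  rw [← compl_Iio, probReal_compl_eq_one_sub measurableSet_Iio]
  have hlim : Filter.Tendsto (fun n : ℕ => μ.real (Iic (x - 1 / (n + 1)))) Filter.atTop
      (nhds (μ.real (Iio x))) := by
    have hU : Iio x = ⋃ n : ℕ, Iic (x - 1 / ((n : ℝ) + 1)) := by
      ext y
      simp only [mem_Iio, mem_iUnion, mem_Iic]
      constructor
      · intro hy
        obtain ⟨n, hn⟩ := exists_nat_one_div_lt (sub_pos.2 hy)
        exact ⟨n, by linarith⟩
      · rintro ⟨n, hn⟩
        have : (0 : ℝ) < 1 / (n + 1) := by positivity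
        linarith
    rw [hU]
    refine (ENNReal.tendsto_toReal (measure_ne_top _ _)).comp (tendsto_measure_iUnion_atTop ?_)
    intro m n hmn
    refine Iic_subset_Iic.2 (sub_le_sub_left ?_ _)
    exact Nat.one_div_le_one_div hmn
  have : μ.real (Iio x) ≤ 1 / 2 := by
    refine le_of_tendsto' hlim fun n => ?_
    by_contra! H
    have h1 := hx.trans (quantile_half_le_iff.2 H.le)
    rw [EReal.coe_le_coe_iff] at h1
    have : (0 : ℝ) < 1 / (n + 1) := by positivity
    linarith
  linarith

/-- Here `ρ` is the distance to the closed half-line bounded by `x` that contains the median; its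
mass is at least 1/2. -/
theorem TransportEntropy.moment_le (hβ : IsCost β h) {a : ℝ} (ha : 0 < a)
    {μ : Measure ℝ} [IsProbabilityMeasure μ] (hT : TransportEntropy β a μ) :
    max (lowerMoment β μ (a / 2)) (upperMoment β μ (a / 2)) ≤ 3 := by
  refine max_le (iSup_le fun x => iSup_le fun h1 => iSup_le fun h2 => ?_)
    (iSup_le fun x => iSup_le fun h1 => iSup_le fun h2 => ?_)
  · have hset : {y : ℝ | max (x - y) 0 = 0} = Ici x := by
      ext y; simp
    have := hT.lintegral_cond_le hβ ha (ρ := fun y => max (x - y) 0) (by fun_prop)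
      (fun y => le_max_right _ _)
      (fun y z => max_le (by
        have := le_max_left (x - z) 0
        have := neg_abs_le (y - z)
        linarith) (by positivity))
      (by rw [hset, compl_Ici]; exact suppInf_lt_iff.1 h1)
      (by rw [hset]; exact half_le_of_le_quantile h2)
    rw [hset, compl_Ici] at this
    refine (setLIntegral_le_lintegral _ _).trans ((lintegral_map_le _ _).trans (le_trans ?_ this))
    refine lintegral_mono_ae ?_
    have hmem : ∀ᵐ y ∂(cond μ (Iio x)), y ∈ Iio x := by
      rw [ae_iff, ← compl_def, cond_apply measurableSet_Iio, inter_compl_self, measure_empty,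
        mul_zero]
    filter_upwards [hmem] with y hy
    rw [max_eq_left (sub_nonneg.2 (le_of_lt hy))]
  · have hset : {y : ℝ | max (y - x) 0 = 0} = Iic x := by
      ext y; simp
    have := hT.lintegral_cond_le hβ ha (ρ := fun y => max (y - x) 0) (by fun_prop)
      (fun y => le_max_right _ _)
      (fun y z => max_le (by
        have := le_max_left (z - x) 0
        have := le_abs_self (y - z)
        linarith) (by positivity))
      (by rw [hset, compl_Iic]; exact lt_suppSup_iff.1 h2)
      (by rw [hset]; exact quantile_half_le_iff.1 h1)
    rw [hset, compl_Iic] at this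
    refine (setLIntegral_le_lintegral _ _).trans ((lintegral_map_le _ _).trans (le_trans ?_ this))
    refine lintegral_mono_ae ?_
    have hmem : ∀ᵐ y ∂(cond μ (Ioi x)), y ∈ Ioi x := by
      rw [ae_iff, ← compl_def, cond_apply measurableSet_Ioi, inter_compl_self, measure_empty,
        mul_zero]
    filter_upwards [hmem] with y hy
    rw [max_eq_left (sub_nonneg.2 (le_of_lt hy))]

/-! ### From exponential moments to expansion of `S`. -/

/-- Markov's inequality for the conditional tail. The intersection matters only when `x = y`, where
an atom at `x` must not be counted. -/
theorem real_le_of_upperMoment_le (hβ : IsCost β h) {b K : ℝ} (hb : 0 < b) (hK : 0 < K)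
    {μ : Measure ℝ} [IsProbabilityMeasure μ] (hu : upperMoment β μ b ≤ ENNReal.ofReal K)
    {x y : ℝ} (hxy : x ≤ y) (hx : quantile μ (1 / 2) ≤ x) :
    μ.real (Ioi x ∩ Ici y) ≤ μ.real (Ioi x) * (K * Real.exp (-β (b * (y - x)))) := by
  by_cases h0 : μ (Ioi x) = 0
  · rw [measureReal_def, measure_mono_null inter_subset_left h0]
    simp only [ENNReal.toReal_zero]
    positivity
  have h1 : ∫⁻ u in Ici 0, ENNReal.ofReal (Real.exp (β (b * u))) ∂(upperTail μ x) ≤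
      ENNReal.ofReal K := by
    refine le_trans ?_ hu
    unfold upperMoment
    exact le_iSup_of_le x (le_iSup_of_le hx (le_iSup_of_le (lt_suppSup_iff.2 h0) le_rfl))
  have h2 : ENNReal.ofReal (Real.exp (β (b * (y - x)))) * upperTail μ x (Ici (y - x)) ≤
      ENNReal.ofReal K := by
    refine le_trans ?_ h1
    rw [← setLIntegral_const]
    refine le_trans (setLIntegral_mono' measurableSet_Ici fun u hu => ?_)
      (lintegral_mono_set (Ici_subset_Ici.2 (sub_nonneg.2 hxy)))
    refine ENNReal.ofReal_le_ofReal (Real.exp_le_exp.2 (hβ.mono ?_ ?_))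
    · exact mul_nonneg hb.le (sub_nonneg.2 hxy)
    · exact mul_le_mul_of_nonneg_left hu hb.le
  have hpre : (fun u : ℝ => u - x) ⁻¹' Ici (y - x) = Ici y := by
    ext u; simp
  rw [upperTail, Measure.map_apply (by fun_prop) measurableSet_Ici, hpre,
    cond_apply measurableSet_Ioi] at h2
  have h3 := ENNReal.toReal_mono ENNReal.ofReal_ne_top h2
  have hpos : 0 < μ.real (Ioi x) := ENNReal.toReal_pos h0 (measure_ne_top _ _)
  rw [ENNReal.toReal_mul, ENNReal.toReal_mul, ENNReal.toReal_inv,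
    ENNReal.toReal_ofReal (Real.exp_pos _).le, ENNReal.toReal_ofReal hK.le,
    ← measureReal_def, ← measureReal_def] at h3
  rw [Real.exp_neg, ← div_eq_mul_inv, ← mul_div_assoc, le_div_iff₀ (Real.exp_pos _)]
  calc μ.real (Ioi x ∩ Ici y) * Real.exp (β (b * (y - x)))
      = μ.real (Ioi x) * (Real.exp (β (b * (y - x))) *
        ((μ.real (Ioi x))⁻¹ * μ.real (Ioi x ∩ Ici y))) := by field_simp
    _ ≤ _ := by gcongr

theorem real_le_of_lowerMoment_le (hβ : IsCost β h) {b K : ℝ} (hb : 0 < b) (hK : 0 < K)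
    {μ : Measure ℝ} [IsProbabilityMeasure μ] (hu : lowerMoment β μ b ≤ ENNReal.ofReal K)
    {x y : ℝ} (hxy : x ≤ y) (hy : y ≤ quantile μ (1 / 2)) :
    μ.real (Iio y ∩ Iic x) ≤ μ.real (Iio y) * (K * Real.exp (-β (b * (y - x)))) := by
  by_cases h0 : μ (Iio y) = 0
  · rw [measureReal_def, measure_mono_null inter_subset_left h0]
    simp only [ENNReal.toReal_zero]
    positivity
  have h1 : ∫⁻ u in Ici 0, ENNReal.ofReal (Real.exp (β (b * u))) ∂(lowerTail μ y) ≤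
      ENNReal.ofReal K := by
    refine le_trans ?_ hu
    unfold lowerMoment
    exact le_iSup_of_le y (le_iSup_of_le (suppInf_lt_iff.2 h0) (le_iSup_of_le hy le_rfl))
  have h2 : ENNReal.ofReal (Real.exp (β (b * (y - x)))) * lowerTail μ y (Ici (y - x)) ≤
      ENNReal.ofReal K := by
    refine le_trans ?_ h1
    rw [← setLIntegral_const]
    refine le_trans (setLIntegral_mono' measurableSet_Ici fun u hu => ?_)
      (lintegral_mono_set (Ici_subset_Ici.2 (sub_nonneg.2 hxy)))
    refine ENNReal.ofReal_le_ofReal (Real.exp_le_exp.2 (hβ.mono ?_ ?_))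
    · exact mul_nonneg hb.le (sub_nonneg.2 hxy)
    · exact mul_le_mul_of_nonneg_left hu hb.le
  have hpre : (fun u : ℝ => y - u) ⁻¹' Ici (y - x) = Iic x := by
    ext u; simp
  rw [lowerTail, Measure.map_apply (by fun_prop) measurableSet_Ici, hpre,
    cond_apply measurableSet_Iio] at h2
  have h3 := ENNReal.toReal_mono ENNReal.ofReal_ne_top h2
  have hpos : 0 < μ.real (Iio y) := ENNReal.toReal_pos h0 (measure_ne_top _ _)
  rw [ENNReal.toReal_mul, ENNReal.toReal_mul, ENNReal.toReal_inv,
    ENNReal.toReal_ofReal (Real.exp_pos _).le, ENNReal.toReal_ofReal hK.le,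
    ← measureReal_def, ← measureReal_def] at h3
  rw [Real.exp_neg, ← div_eq_mul_inv, ← mul_div_assoc, le_div_iff₀ (Real.exp_pos _)]
  calc μ.real (Iio y ∩ Iic x) * Real.exp (β (b * (y - x)))
      = μ.real (Iio y) * (Real.exp (β (b * (y - x))) *
        ((μ.real (Iio y))⁻¹ * μ.real (Iio y ∩ Iic x))) := by field_simp
    _ ≤ _ := by gcongr

/-- If `K < 1`, the tail bounds with both points at the median say that each open half-line has mass
at most `K` times itself, so `μ` is a Dirac mass. Hence `log K ≥ 0`, where the inverse of `β` is
meaningful. -/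
theorem one_le_of_moment_le (hβ : IsCost β h) {b K : ℝ} (hb : 0 < b) (hK : 0 < K)
    {μ : Measure ℝ} [IsProbabilityMeasure μ] (hμ : ¬ ∃ x : ℝ, μ = Measure.dirac x)
    (hl : lowerMoment β μ b ≤ ENNReal.ofReal K) (hu : upperMoment β μ b ≤ ENNReal.ofReal K) :
    1 ≤ K := by
  obtain ⟨m, hm, -⟩ := exists_quantile_eq μ (p := 1 / 2) (by norm_num) (by norm_num)
  have h1 := real_le_of_upperMoment_le hβ hb hK hu (le_refl m) hm.le
  have h2 := real_le_of_lowerMoment_le hβ hb hK hl (le_refl m) hm.ge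
  rw [inter_eq_left.2 Ioi_subset_Ici_self] at h1
  rw [inter_eq_left.2 Iio_subset_Iic_self] at h2
  simp only [sub_self, mul_zero, hβ.map_zero, neg_zero, Real.exp_zero, mul_one] at h1 h2
  by_contra! hK1
  have h3 : μ.real (Ioi m) = 0 := by
    have : 0 ≤ μ.real (Ioi m) := measureReal_nonneg
    nlinarith
  have h4 : μ.real (Iio m) = 0 := by
    have : 0 ≤ μ.real (Iio m) := measureReal_nonneg
    nlinarith
  rw [measureReal_eq_zero_iff] at h3 h4
  refine hμ ⟨m, ?_⟩
  have hae : ∀ᵐ x ∂μ, x = m := by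
    rw [ae_iff]
    refine measure_mono_null (fun x hx => ?_) (measure_union_null h4 h3)
    exact lt_or_gt_of_ne hx
  have : μ.map (fun x : ℝ => x) = μ.map fun _ => m := Measure.map_congr hae
  rw [Measure.map_id', Measure.map_const, measure_univ, one_smul] at this
  exact this

theorem log_two_mul_le {p q K B : ℝ} (hq : 0 < q) (hp : 0 ≤ p) (hK : 0 < K)
    (hqp : q ≤ p * (K * Real.exp (-B))) :
    Real.log (2 * q) ≤ Real.log (2 * p) + Real.log K - B := by
  have hp' : 0 < p := by
    rcases hp.eq_or_lt with rfl | h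
    · rw [zero_mul] at hqp; linarith
    · exact h
  have : Real.log (2 * q) ≤ Real.log (2 * p * (K * Real.exp (-B))) :=
    Real.log_le_log (by positivity) (by linarith)
  rw [Real.log_mul (x := 2 * p) (by positivity) (by positivity),
    Real.log_mul (x := K) (by positivity) (by positivity), Real.log_exp] at this
  linarith

/-- Write `w` for the inverse of `β` at `y`. The hypothesis `hr` forces `b r > 4 w`, and since `h ≤
w` the argument on the left is at most `b r / 4 ≤ b r / 2 - w ≤ b s - w`. Superadditivity then costs
exactly `β w = y`. This is the origin of the factor 4. -/
theorem IsCost.le_sub_of_half_le (hβ : IsCost β h) {b r s y : ℝ} (hb : 0 < b) (hy : 0 ≤ y)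
    (hs : r / 2 ≤ s) (hr : h < b * (h / (4 * rightInv β h y)) * r) :
    β (b * (h / (4 * rightInv β h y)) * r) ≤ β (b * s) - y := by
  have hw := hβ.le_rightInv hy
  have hmap := hβ.map_rightInv hy
  set w := rightInv β h y
  have hh := hβ.pos
  have hw0 : 0 < w := hh.trans_le hw
  have e : b * (h / (4 * w)) * r = b * r * h / (4 * w) := by ring
  rw [e] at hr ⊢
  rw [lt_div_iff₀ (by positivity)] at hr
  have h1 : 4 * w < b * r := by nlinarith
  have h2 : b * (r / 2) ≤ b * s := by gcongr
  have h3 : b * r * h / (4 * w) ≤ b * s - w := by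
    rw [div_le_iff₀ (by positivity)]
    nlinarith
  have h4 := hβ.add_le hw0.le (by linarith : 0 ≤ b * s - w)
  have h5 := hβ.mono (div_nonneg (mul_nonneg (by linarith) hh.le) (by positivity)) h3
  rw [add_sub_cancel] at h4
  linarith

theorem expQuantile_sub_ge (hβ : IsCost β h) {b K : ℝ} (hb : 0 < b) (hK : 1 ≤ K)
    {μ : Measure ℝ} [IsProbabilityMeasure μ]
    (hl : lowerMoment β μ b ≤ ENNReal.ofReal K) (hu : upperMoment β μ b ≤ ENNReal.ofReal K)
    {x y : ℝ} (hxy : x < y) (hx : 0 < μ.real (Iic x)) (hy : μ.real (Iio y) < 1) :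
    β (b * (h / (4 * rightInv β h (Real.log K))) * (y - x)) ≤
      expQuantile (μ.real (Iio y)) - expQuantile (μ.real (Iic x)) := by
  have hK0 : 0 < K := by linarith
  have hlog : 0 ≤ Real.log K := Real.log_nonneg hK
  have hPQ : μ.real (Iic x) ≤ μ.real (Iio y) := measureReal_mono (Iic_subset_Iio.2 hxy)
  have hmono := expQuantile_mono hx hPQ hy
  set c := b * (h / (4 * rightInv β h (Real.log K)))
  have hc : 0 < c := by
    have := hβ.rightInv_pos hlog
    have := hβ.pos
    positivity
  -- For short gaps `β` vanishes and monotonicity of quantiles is enough.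
  rcases le_or_gt (c * (y - x)) h with hr | hr
  · rw [hβ.zero _ ⟨mul_nonneg hc.le (by linarith), hr⟩]
    linarith
  have hIci : ∀ z, μ.real (Ici z) = 1 - μ.real (Iio z) := fun z => by
    rw [← compl_Iio, probReal_compl_eq_one_sub measurableSet_Iio]
  have hIoi : ∀ z, μ.real (Ioi z) = 1 - μ.real (Iic z) := fun z => by
    rw [← compl_Iic, probReal_compl_eq_one_sub measurableSet_Iic]
  have hup : ∀ z, z < y → quantile μ (1 / 2) ≤ z → Real.log (2 * (1 - μ.real (Iio y))) ≤
      Real.log (2 * (1 - μ.real (Iic z))) + Real.log K - β (b * (y - z)) := by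
    intro z hz hmz
    have := real_le_of_upperMoment_le hβ hb hK0 hu hz.le hmz
    rw [inter_eq_right.2 (Ici_subset_Ioi.2 hz), hIci, hIoi] at this
    exact log_two_mul_le (by linarith) (sub_nonneg.2 measureReal_le_one) hK0 this
  have hlo : ∀ z, x < z → z ≤ quantile μ (1 / 2) → Real.log (2 * μ.real (Iic x)) ≤
      Real.log (2 * μ.real (Iio z)) + Real.log K - β (b * (z - x)) := by
    intro z hz hmz
    have := real_le_of_lowerMoment_le hβ hb hK0 hl hz.le hmz
    rw [inter_eq_right.2 (Iic_subset_Iio.2 hz)] at this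
    exact log_two_mul_le hx measureReal_nonneg hK0 this
  obtain ⟨m, hm, hm'⟩ := exists_quantile_eq μ (p := 1 / 2) (by norm_num) (by norm_num)
  have hmIic : 1 / 2 ≤ μ.real (Iic m) := quantile_half_le_iff.1 hm.le
  have hmIio : μ.real (Iio m) ≤ 1 / 2 := by
    have := half_le_of_le_quantile hm.ge
    rw [hIci] at this
    linarith
  rcases le_or_gt m x with hmx | hmx
  · have hP : 1 / 2 ≤ μ.real (Iic x) := hmIic.trans (measureReal_mono (Iic_subset_Iic.2 hmx))
    rw [expQuantile_of_ge hP, expQuantile_of_ge (hP.trans hPQ)]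
    have h1 := hup x hxy (by rw [hm]; exact_mod_cast hmx)
    have h2 := hβ.le_sub_of_half_le hb hlog (by linarith : (y - x) / 2 ≤ y - x) hr
    linarith
  rcases le_or_gt y m with hym | hym
  · have hQ : μ.real (Iio y) ≤ 1 / 2 := (measureReal_mono (Iio_subset_Iio hym)).trans hmIio
    rw [expQuantile_of_le hQ, expQuantile_of_le (hPQ.trans hQ)]
    have h1 := hlo y hxy (by rw [hm]; exact_mod_cast hym)
    have h2 := hβ.le_sub_of_half_le hb hlog (by linarith : (y - x) / 2 ≤ y - x) hr
    linarith
  have hP : μ.real (Iic x) ≤ 1 / 2 := (measureReal_mono (Iic_subset_Iio.2 hmx)).trans hmIio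
  have hQ : 1 / 2 ≤ μ.real (Iio y) := hmIic.trans (measureReal_mono (Iic_subset_Iio.2 hym))
  rw [expQuantile_of_ge hQ, expQuantile_of_le hP]
  have hP0 : Real.log (2 * μ.real (Iic x)) ≤ 0 := Real.log_nonpos (by linarith) (by linarith)
  have hQ0 : Real.log (2 * (1 - μ.real (Iio y))) ≤ 0 :=
    Real.log_nonpos (by linarith) (by linarith)
  -- The median lies strictly between `x` and `y`, so one side of it carries at least half of the
  -- gap. The tail bound is used on that side only; the logarithm from the other side has the
  -- favourable sign.
  rcases le_total ((y - x) / 2) (y - m) with hh | hh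
  · have h1 := hup m hym hm.le
    have h2 := hβ.le_sub_of_half_le hb hlog hh hr
    have h3 : Real.log (2 * (1 - μ.real (Iic m))) ≤ 0 :=
      Real.log_nonpos (mul_nonneg zero_le_two (sub_nonneg.2 measureReal_le_one)) (by linarith)
    linarith
  · have h1 := hlo m hmx hm.ge
    have h2 := hβ.le_sub_of_half_le hb hlog (by linarith : (y - x) / 2 ≤ m - x) hr
    have h3 : Real.log (2 * μ.real (Iio m)) ≤ 0 :=
      Real.log_nonpos (mul_nonneg zero_le_two measureReal_nonneg) (by linarith)
    linarith

theorem real_Iic_eq_add (μ : Measure ℝ) [IsProbabilityMeasure μ] (x : ℝ) :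
    μ.real (Iic x) = μ.real (Iio x) + μ.real {x} := by
  rw [← Iio_union_right, measureReal_union (by simp) (measurableSet_singleton x)]

theorem planExpansion_of_moment_le (hβ : IsCost β h) {b K : ℝ} (hb : 0 < b) (hK : 0 < K)
    {μ : Measure ℝ} [IsProbabilityMeasure μ] (hμ : ¬ ∃ x : ℝ, μ = Measure.dirac x)
    (hmax : max (lowerMoment β μ b) (upperMoment β μ b) ≤ ENNReal.ofReal K) :
    PlanExpansion β (b * (h / (4 * rightInv β h (Real.log K)))) μ := by
  obtain ⟨hl, hu⟩ := max_le_iff.1 hmax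
  have hK1 := one_le_of_moment_le hβ hb hK hμ hl hu
  -- For `x < y` the extreme case is `u = 1` and `v = 0`, since `S` increases in its second
  -- variable; only `F_μ(x)` and the left limit of `F_μ` at `y` matter.
  have main : ∀ x y : ℝ, x < y → ∀ u ∈ Icc (0 : ℝ) 1, ∀ v ∈ Icc (0 : ℝ) 1,
      0 < μ.real (Iio x) + μ.real {x} * u → μ.real (Iio y) + μ.real {y} * v < 1 →
      β (b * (h / (4 * rightInv β h (Real.log K))) * (y - x)) ≤
        expQuantile (μ.real (Iio y) + μ.real {y} * v) -
          expQuantile (μ.real (Iio x) + μ.real {x} * u) := by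
    intro x y hxy u hu' v hv hp hq
    have hp' : μ.real (Iio x) + μ.real {x} * u ≤ μ.real (Iic x) := by
      rw [real_Iic_eq_add]
      have := mul_le_mul_of_nonneg_left hu'.2 (measureReal_nonneg (μ := μ) (s := {x}))
      linarith
    have hq' : μ.real (Iio y) ≤ μ.real (Iio y) + μ.real {y} * v :=
      le_add_of_nonneg_right (mul_nonneg measureReal_nonneg hv.1)
    have hPQ : μ.real (Iic x) ≤ μ.real (Iio y) := measureReal_mono (Iic_subset_Iio.2 hxy)
    have h1 := expQuantile_sub_ge hβ hb hK1 hl hu hxy (hp.trans_le hp') (hq'.trans_lt hq)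
    have h2 := expQuantile_mono hp hp' (hPQ.trans_lt (hq'.trans_lt hq))
    have h3 := expQuantile_mono ((hp.trans_le hp').trans_le hPQ) hq' hq
    linarith
  intro x y u hu' v hv htop hbot
  unfold transportPlanMap at *
  set p := μ.real (Iio x) + μ.real {x} * u with hp
  set q := μ.real (Iio y) + μ.real {y} * v with hq
  rcases le_or_gt p 0 with hp0 | hp0
  · rw [quantile_of_nonpos _ hp0]; simp
  rcases le_or_gt 1 p with hp1 | hp1
  · rw [quantile_expTwoSided_of_ge hp1] at htop ⊢
    rw [EReal.top_sub fun H => htop ⟨rfl, H⟩]; simp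
  rcases le_or_gt q 0 with hq0 | hq0
  · rw [quantile_of_nonpos _ hq0, quantile_expTwoSided hp0 hp1, EReal.coe_sub_bot]; simp
  rcases le_or_gt 1 q with hq1 | hq1
  · rw [quantile_expTwoSided_of_ge hq1, EReal.sub_top]; simp
  rw [quantile_expTwoSided hp0 hp1, quantile_expTwoSided hq0 hq1, ← EReal.coe_sub, EReal.abs_def]
  refine ENNReal.ofReal_le_ofReal ?_
  rcases lt_trichotomy x y with hxy | rfl | hxy
  · rw [abs_sub_comm x, abs_of_pos (sub_pos.2 hxy), abs_sub_comm (expQuantile p)]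
    exact (main x y hxy u hu' v hv hp0 hq1).trans (le_abs_self _)
  · rw [sub_self, abs_zero, mul_zero, hβ.map_zero]; positivity
  · rw [abs_of_pos (sub_pos.2 hxy)]
    exact (main y x hxy v hv u hu' hq0 hp1).trans (le_abs_self _)

/-! ### From expansion of `S` to contraction of `T`. -/

/-- At `x = T u` the level `F_{μ₁}(u)` lies between the left limit and the value of `F_μ`, so it is
reached by a fraction `s` of the atom at `x`. -/
theorem exists_transportMap_eq (μ : Measure ℝ) [IsProbabilityMeasure μ] (u : ℝ) :
    ∃ x : ℝ, transportMap expTwoSided μ u = x ∧ ∃ s ∈ Icc (0 : ℝ) 1,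
      transportPlanMap μ expTwoSided x s = u := by
  obtain ⟨x, hx, hx'⟩ := exists_quantile_eq μ (expCdf_pos u) (expCdf_lt_one u)
  refine ⟨x, by rw [transportMap, cdf_expTwoSided, hx], ?_⟩
  have h1 : expCdf u ≤ μ.real (Iio x) + μ.real {x} := by
    rw [← real_Iic_eq_add, ← cdf_eq_real]; exact (hx' x).1 le_rfl
  -- Otherwise, by the left limit, some `y < x` would already reach the level, against minimality of
  -- `x`.
  have h2 : μ.real (Iio x) ≤ expCdf u := by
    by_contra! H
    have hcont : Filter.Tendsto (cdf μ) (nhdsWithin x (Iio x)) (nhds (μ.real (Iio x))) := by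
      have := (cdf μ).mono.tendsto_leftLim x
      convert this using 2
      rw [measureReal_def]
      nth_rewrite 1 [← measure_cdf μ]
      rw [StieltjesFunction.measure_Iio _ (tendsto_cdf_atBot μ), sub_zero, ENNReal.toReal_ofReal]
      refine ge_of_tendsto this (.of_forall fun y => cdf_nonneg μ y)
    obtain ⟨y, hy, hyx⟩ := ((hcont.eventually (eventually_gt_nhds H)).and
      self_mem_nhdsWithin).exists
    exact absurd ((hx' y).2 hy.le) (not_le.2 hyx)
  have key : ∃ s ∈ Icc (0 : ℝ) 1, μ.real (Iio x) + μ.real {x} * s = expCdf u := by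
    rcases (measureReal_nonneg (μ := μ) (s := {x})).eq_or_lt with h0 | h0
    · exact ⟨0, by simp, by rw [mul_zero]; linarith⟩
    · refine ⟨(expCdf u - μ.real (Iio x)) / μ.real {x},
        ⟨div_nonneg (by linarith) h0.le, (div_le_one h0).2 (by linarith)⟩, ?_⟩
      rw [mul_div_cancel₀ _ h0.ne']; ring
  obtain ⟨s, hs, hs'⟩ := key
  exact ⟨s, hs, by rw [transportPlanMap, hs', quantile_expCdf]⟩

theorem PlanExpansion.mapContraction (hβ : IsCost β h) {c : ℝ} (hc : 0 < c)
    {μ : Measure ℝ} [IsProbabilityMeasure μ] (hS : PlanExpansion β c μ) :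
    MapContraction β h c μ := by
  intro u v _
  obtain ⟨x, hx, s, hs, hxs⟩ := exists_transportMap_eq μ u
  obtain ⟨y, hy, t, ht, hyt⟩ := exists_transportMap_eq μ v
  have := hS x y s hs t ht (by simp [hxs]) (by simp [hxs])
  rw [hxs, hyt, ← EReal.coe_sub, EReal.abs_def,
    ENNReal.ofReal_le_ofReal_iff (abs_nonneg _)] at this
  rw [hx, hy, ← EReal.coe_sub, EReal.abs_def]
  refine ENNReal.ofReal_le_ofReal ?_
  rw [one_div, ← div_eq_inv_mul, le_div_iff₀' hc]
  exact hβ.le_rightInv_of_le (abs_nonneg _) this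

/-! ### Test functions whose derivative is an indicator. -/

/-- Tonelli's theorem for the primitive of an integrable function. -/
theorem integral_primitive {θ : ℝ → ℝ} (hθ : Integrable θ) (ν : Measure ℝ)
    [IsProbabilityMeasure ν] :
    ∫ y, (∫ x in (0 : ℝ)..y, θ x) ∂ν =
      ∫ x, θ x * (ν.real (Ici x) - (Iic (0 : ℝ)).indicator 1 x) := by
  -- The difference of two indicators encodes the orientation of the interval for both signs of `y`.
  have h1 : ∀ y, ∫ x in (0 : ℝ)..y, θ x =
      ∫ x, θ x * ((Iic y).indicator 1 x - (Iic (0 : ℝ)).indicator 1 x) := by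
    intro y
    rw [← intervalIntegral.integral_Iic_sub_Iic hθ.integrableOn hθ.integrableOn,
      ← integral_indicator measurableSet_Iic, ← integral_indicator measurableSet_Iic,
      ← integral_sub (hθ.indicator measurableSet_Iic) (hθ.indicator measurableSet_Iic)]
    congr with x
    by_cases h2 : x ≤ y <;> by_cases h3 : x ≤ 0 <;> simp [h2, h3]
  simp_rw [h1]
  rw [integral_integral_swap]
  · congr with x
    rw [integral_const_mul, integral_sub _ (integrable_const _)]
    · congr 2
      · rw [show (fun y => (Iic y).indicator (1 : ℝ → ℝ) x) = (Ici x).indicator 1 from ?_,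
          integral_indicator_one measurableSet_Ici]
        ext y
        by_cases h2 : x ≤ y <;> simp [h2]
      · simp
    · rw [show (fun y => (Iic y).indicator (1 : ℝ → ℝ) x) = (Ici x).indicator 1 from ?_]
      · exact (integrable_const (1 : ℝ)).indicator measurableSet_Ici
      · ext y
        by_cases h2 : x ≤ y <;> simp [h2]
  · have hset : MeasurableSet {p : ℝ × ℝ | p.2 ≤ p.1} :=
      measurableSet_le measurable_snd measurable_fst
    have hm : Measurable fun p : ℝ × ℝ =>
        (Iic p.1).indicator (1 : ℝ → ℝ) p.2 - (Iic (0 : ℝ)).indicator 1 p.2 := by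
      refine Measurable.sub ?_ ((measurable_one.indicator measurableSet_Iic).comp measurable_snd)
      have : (fun p : ℝ × ℝ => (Iic p.1).indicator (1 : ℝ → ℝ) p.2) =
          {p : ℝ × ℝ | p.2 ≤ p.1}.indicator 1 := by
        ext p
        by_cases h2 : p.2 ≤ p.1 <;> simp [h2]
      rw [this]
      exact measurable_one.indicator hset
    refine (hθ.comp_snd ν).mul_bdd (c := 1) hm.aestronglyMeasurable (.of_forall fun p => ?_)
    by_cases h2 : p.2 ≤ p.1 <;> by_cases h3 : p.2 ≤ 0 <;> simp [h2, h3]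

/-- The signed length of the part of `A` between `0` and `y`. -/
noncomputable def signedLength (A : Set ℝ) (y : ℝ) : ℝ := ∫ x in (0 : ℝ)..y, A.indicator 1 x

section SignedLength

variable {A : Set ℝ}

theorem locallyIntegrable_indicator_one (hA : MeasurableSet A) :
    LocallyIntegrable (A.indicator (1 : ℝ → ℝ)) :=
  (locallyIntegrable_const (1 : ℝ)).indicator hA

theorem intervalIntegrable_indicator_one (hA : MeasurableSet A) (x y : ℝ) :
    IntervalIntegrable (A.indicator (1 : ℝ → ℝ)) volume x y :=
  intervalIntegrable_iff.2 (((locallyIntegrable_indicator_one hA).integrableOn_isCompact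
    isCompact_uIcc).mono_set uIoc_subset_uIcc)

theorem signedLength_sub (hA : MeasurableSet A) (x y : ℝ) :
    signedLength A y - signedLength A x = ∫ t in x..y, A.indicator 1 t :=
  intervalIntegral.integral_interval_sub_left
    (intervalIntegrable_indicator_one hA _ _) (intervalIntegrable_indicator_one hA _ _)

theorem signedLength_mono (hA : MeasurableSet A) : Monotone (signedLength A) := by
  intro x y hxy
  have := signedLength_sub hA x y
  have h0 : 0 ≤ ∫ t in x..y, A.indicator (1 : ℝ → ℝ) t :=
    intervalIntegral.integral_nonneg hxy fun t _ => indicator_nonneg (fun _ _ => zero_le_one) _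
  linarith

theorem signedLength_zero : signedLength A 0 = 0 := intervalIntegral.integral_same

theorem signedLength_lipschitz (hA : MeasurableSet A) : LipschitzWith 1 (signedLength A) := by
  refine LipschitzWith.of_dist_le_mul fun y x => ?_
  rw [Real.dist_eq, signedLength_sub hA, NNReal.coe_one, one_mul, Real.dist_eq, ← Real.norm_eq_abs]
  have := intervalIntegral.norm_integral_le_of_norm_le_const (a := x) (b := y) (C := 1)
    (f := A.indicator (1 : ℝ → ℝ)) fun t _ => by
      by_cases h : t ∈ A <;> simp [h]
  simpa using this

theorem abs_signedLength_le (hA : MeasurableSet A) {R : ℝ} (hR : A ⊆ Icc (-R) R) (y : ℝ) :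
    |signedLength A y| ≤ ∫ x, A.indicator (1 : ℝ → ℝ) x := by
  have hint : Integrable (A.indicator (1 : ℝ → ℝ)) :=
    (integrable_indicator_iff hA).2 ((integrableOn_const (C := (1 : ℝ)) (by simp)).mono_set hR)
  have h0 : ∀ x, 0 ≤ A.indicator (1 : ℝ → ℝ) x := indicator_nonneg fun _ _ => zero_le_one
  have hle : |signedLength A y| ≤ ∫ x in uIoc 0 y, ‖A.indicator (1 : ℝ → ℝ) x‖ := by
    rw [← Real.norm_eq_abs]
    exact intervalIntegral.norm_integral_le_integral_norm_uIoc
  refine hle.trans ?_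
  simp_rw [Real.norm_of_nonneg (h0 _)]
  exact setIntegral_le_integral hint (.of_forall h0)

/-- The fundamental theorem of calculus for the exponential of `signedLength`. -/
theorem exp_signedLength_sub_one (hA : MeasurableSet A) (c y : ℝ) :
    Real.exp (c * signedLength A y) - 1 =
      ∫ x in (0 : ℝ)..y, A.indicator (fun x => c * Real.exp (c * signedLength A x)) x := by
  set f : ℝ → ℝ := fun x => Real.exp (c * signedLength A x) with hf
  -- `signedLength` is Lipschitz with bounded range on the interval, where the exponential is
  -- Lipschitz too; the derivative is then found almost everywhere by Lebesgue differentiation.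
  have hAC : AbsolutelyContinuousOnInterval f 0 y := by
    obtain ⟨K, hK⟩ := (ContDiff.contDiffOn (n := 1) (s := Icc (signedLength A (min 0 y))
      (signedLength A (max 0 y))) (f := fun t : ℝ => Real.exp (c * t))
      (by fun_prop)).exists_lipschitzOnWith (by decide) (convex_Icc _ _) isCompact_Icc
    refine LipschitzOnWith.absolutelyContinuousOnInterval (K := K * 1)
      (hK.comp (signedLength_lipschitz hA).lipschitzOnWith fun x hx => ?_)
    exact ⟨signedLength_mono hA hx.1, signedLength_mono hA hx.2⟩
  have h1 := hAC.integral_deriv_eq_sub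
  have h2 : f 0 = 1 := by simp [hf, signedLength_zero]
  rw [h2] at h1
  rw [← h1]
  refine intervalIntegral.integral_congr_ae ?_
  filter_upwards [LocallyIntegrable.ae_hasDerivAt_integral
    (locallyIntegrable_indicator_one hA)] with x hx _
  have h3 : HasDerivAt f (f x * (c * A.indicator 1 x)) x := ((hx 0).const_mul c).exp
  rw [h3.deriv]
  by_cases h : x ∈ A <;> simp [h, hf, mul_comm]

theorem integrableOn_exp_mul (hA : MeasurableSet A) {R : ℝ} (hR : A ⊆ Icc (-R) R) (c : ℝ)
    {w : ℝ → ℝ} (hw : Continuous w) :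
    IntegrableOn (fun x => Real.exp (c * signedLength A x) * w x) A := by
  have : Continuous fun x => Real.exp (c * signedLength A x) * w x :=
    (Real.continuous_exp.comp (continuous_const.mul (signedLength_lipschitz hA).continuous)).mul hw
  exact (this.integrableOn_Icc (a := -R) (b := R)).mono_set hR

theorem integrableOn_exp_neg_abs {R : ℝ} (hR : A ⊆ Icc (-R) R) :
    IntegrableOn (fun x => Real.exp (-|x|) / 2) A :=
  (Continuous.integrableOn_Icc (a := -R) (b := R) (by fun_prop)).mono_set hR

theorem integrable_exp_signedLength (hA : MeasurableSet A) {R : ℝ} (hR : A ⊆ Icc (-R) R) (c : ℝ)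
    (μ : Measure ℝ) [IsProbabilityMeasure μ] :
    Integrable (fun x => Real.exp (c * signedLength A x)) μ := by
  have : Continuous fun x => Real.exp (c * signedLength A x) :=
    Real.continuous_exp.comp (continuous_const.mul (signedLength_lipschitz hA).continuous)
  refine Integrable.of_bound this.aestronglyMeasurable
    (Real.exp (|c| * ∫ x, A.indicator (1 : ℝ → ℝ) x)) (.of_forall fun x => ?_)
  rw [Real.norm_of_nonneg (Real.exp_pos _).le]
  refine Real.exp_le_exp.2 ((le_abs_self _).trans ?_)
  rw [abs_mul]
  exact mul_le_mul_of_nonneg_left (abs_signedLength_le hA hR x) (abs_nonneg c)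

theorem expTwoSided_real_Ici (x : ℝ) : expTwoSided.real (Ici x) = 1 - expCdf x := by
  rw [← expTwoSided_real_Iic, ← probReal_compl_eq_one_sub measurableSet_Iic, compl_Iic]
  rw [measureReal_def, measureReal_def, ← Ioi_union_left, measure_union (by simp) (by simp),
    expTwoSided_singleton, add_zero]

/-- The property special to the exponential law: on each side of 0 the outer tail equals the
density. Integration by parts thus returns an integral against the same law. -/
theorem expTwoSided_real_Ici_sub (x : ℝ) :
    expTwoSided.real (Ici x) - (Iic (0 : ℝ)).indicator 1 x =
      if 0 < x then Real.exp (-|x|) / 2 else -(Real.exp (-|x|) / 2) := by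
  rw [expTwoSided_real_Ici]
  split_ifs with h
  · rw [expCdf_of_nonneg h.le, abs_of_pos h]; simp [h]
  · rw [expCdf_of_nonpos (not_lt.1 h), abs_of_nonpos (not_lt.1 h)]; simp [not_lt.1 h]

theorem setIntegral_expTwoSided (hA : MeasurableSet A) (f : ℝ → ℝ) :
    ∫ x in A, f x ∂expTwoSided = ∫ x in A, f x * (Real.exp (-|x|) / 2) := by
  rw [expTwoSided, setIntegral_withDensity_eq_setIntegral_toReal_smul₀ (by fun_prop)
    (.of_forall fun x => ENNReal.ofReal_lt_top) _ hA]
  refine integral_congr_ae (.of_forall fun x => ?_)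
  simp only [smul_eq_mul]
  rw [ENNReal.toReal_ofReal (by positivity), mul_comm]

theorem integral_exp_signedLength (hA : MeasurableSet A) {R : ℝ} (hR : A ⊆ Icc (-R) R) (c : ℝ) :
    ∫ y, (Real.exp (c * signedLength A y) - 1) ∂expTwoSided =
      c * ∫ x in A, Real.exp (c * signedLength A x) *
        (if 0 < x then Real.exp (-|x|) / 2 else -(Real.exp (-|x|) / 2)) := by
  simp_rw [exp_signedLength_sub_one hA]
  rw [integral_primitive, ← integral_const_mul, ← integral_indicator hA]
  · congr with x
    rw [expTwoSided_real_Ici_sub]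
    by_cases h : x ∈ A <;> simp [h, mul_assoc]
  · rw [integrable_indicator_iff hA]
    simpa [mul_comm] using integrableOn_exp_mul hA hR c (w := fun _ => c) continuous_const

/-- With `L` the signed length and `X` the integral of `exp(L / 3)` over `A` under the exponential
law, the left side equals `X / 3` and dominates its restriction to `A`, namely `X - μ₁(A)`. Hence `X
≤ 3/2 μ₁(A)`. -/
theorem integral_exp_signedLength_le_of_pos (hA : MeasurableSet A) {R : ℝ} (hR : A ⊆ Icc (-R) R)
    (hpos : A ⊆ Ioi 0) :
    ∫ y, (Real.exp (1 / 3 * signedLength A y) - 1) ∂expTwoSided ≤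
      1 / 2 * ∫ x in A, Real.exp (-|x|) / 2 := by
  have h1 := integral_exp_signedLength hA hR (1 / 3)
  rw [setIntegral_congr_fun hA (g := fun x => Real.exp (1 / 3 * signedLength A x) *
    (Real.exp (-|x|) / 2)) fun x hx => by simp only [if_pos (mem_Ioi.1 (hpos hx))]] at h1
  have hint := (integrable_exp_signedLength hA hR (1 / 3) expTwoSided).sub
    (integrable_const (1 : ℝ))
  have h2 : ∫ y in A, (Real.exp (1 / 3 * signedLength A y) - 1) ∂expTwoSided ≤
      ∫ y, (Real.exp (1 / 3 * signedLength A y) - 1) ∂expTwoSided := by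
    refine setIntegral_le_integral hint (.of_forall fun y => ?_)
    have : 0 ≤ signedLength A y := by
      rcases le_total 0 y with h | h
      · rw [← signedLength_zero (A := A)]; exact signedLength_mono hA h
      · refine (intervalIntegral.integral_zero_ae (.of_forall fun x hx => ?_)).ge
        rw [uIoc_of_ge h] at hx
        exact indicator_of_notMem (fun H => absurd (hpos H) (not_lt.2 hx.2)) _
    exact sub_nonneg.2 (Real.one_le_exp (by positivity))
  rw [setIntegral_expTwoSided hA] at h2
  simp_rw [sub_mul, one_mul] at h2
  rw [integral_sub (integrableOn_exp_mul hA hR _ (by fun_prop))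
    (integrableOn_exp_neg_abs hR)] at h2
  linarith

/-- The same absorption with signs reversed: the left side is `-X / 3`, and `X / 3 ≥ μ₁(A) - X`
gives `X ≥ 3/4 μ₁(A)`. -/
theorem integral_exp_signedLength_le_of_nonpos (hA : MeasurableSet A) {R : ℝ}
    (hR : A ⊆ Icc (-R) R) (hneg : A ⊆ Iic 0) :
    ∫ y, (Real.exp (1 / 3 * signedLength A y) - 1) ∂expTwoSided ≤
      -(1 / 4) * ∫ x in A, Real.exp (-|x|) / 2 := by
  have h1 := integral_exp_signedLength hA hR (1 / 3)
  rw [setIntegral_congr_fun hA (g := fun x => -(Real.exp (1 / 3 * signedLength A x) *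
    (Real.exp (-|x|) / 2))) fun x hx => by
      simp only [if_neg (not_lt.2 (mem_Iic.1 (hneg hx))), mul_neg], integral_neg] at h1
  have hint := (integrable_const (1 : ℝ)).sub
    (integrable_exp_signedLength hA hR (1 / 3) expTwoSided)
  have h2 : ∫ y in A, (1 - Real.exp (1 / 3 * signedLength A y)) ∂expTwoSided ≤
      ∫ y, (1 - Real.exp (1 / 3 * signedLength A y)) ∂expTwoSided := by
    refine setIntegral_le_integral hint (.of_forall fun y => ?_)
    have : signedLength A y ≤ 0 := by
      rcases le_total y 0 with h | h
      · rw [← signedLength_zero (A := A)]; exact signedLength_mono hA h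
      · refine (intervalIntegral.integral_zero_ae (.of_forall fun x hx => ?_)).le
        rw [uIoc_of_le h] at hx
        exact indicator_of_notMem (fun H => absurd (hneg H) (not_le.2 hx.1)) _
    exact sub_nonneg.2 (Real.exp_le_one_iff.2 (by linarith))
  have h3 : ∫ y, (1 - Real.exp (1 / 3 * signedLength A y)) ∂expTwoSided =
      -∫ y, (Real.exp (1 / 3 * signedLength A y) - 1) ∂expTwoSided := by
    rw [← integral_neg]; simp only [neg_sub]
  rw [h3, setIntegral_expTwoSided hA] at h2
  simp_rw [sub_mul, one_mul] at h2
  rw [integral_sub (integrableOn_exp_neg_abs hR)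
    (integrableOn_exp_mul hA hR _ (by fun_prop))] at h2
  linarith

end SignedLength

/-! ### Comparison with the exponential law shifted by 6. -/

/-- The factor 3/2 here, and 3/4 on the other half-line, are three times the constants of the
exponential estimates; a shift by 6 is large enough for both. -/
theorem le_one_sub_expCdf {x : ℝ} (hx : 0 < x) :
    3 / 2 * (Real.exp (-|x|) / 2) ≤ 1 - expCdf (x - 6) := by
  rw [abs_of_pos hx]
  have e3 : Real.exp (-3) ≤ 1 / 8 := by
    rw [Real.exp_neg, inv_le_comm₀ (Real.exp_pos _) (by norm_num)]
    have h1 := Real.add_one_le_exp (1 : ℝ)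
    have h2 : Real.exp 3 = Real.exp 1 ^ 3 := by rw [← Real.exp_nat_mul]; norm_num
    rw [h2]
    have : (2 : ℝ) ^ 3 ≤ Real.exp 1 ^ 3 := pow_le_pow_left₀ (by norm_num) (by linarith) 3
    linarith
  rcases le_total x 6 with h | h
  · rw [expCdf_of_nonpos (by linarith)]
    have h1 : Real.exp (-x) ≤ 1 := Real.exp_le_one_iff.2 (by linarith)
    have h2 : Real.exp (x - 6) ≤ 1 := Real.exp_le_one_iff.2 (by linarith)
    rcases le_total x 3 with h' | h'
    · have h3 : Real.exp (x - 6) ≤ Real.exp (-3) := Real.exp_le_exp.2 (by linarith)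
      linarith
    · have h3 : Real.exp (-x) ≤ Real.exp (-3) := Real.exp_le_exp.2 (by linarith)
      linarith
  · rw [expCdf_of_nonneg (by linarith)]
    have : Real.exp (-(x - 6)) = Real.exp 6 * Real.exp (-x) := by rw [← Real.exp_add]; ring_nf
    have h6 := Real.add_one_le_exp (6 : ℝ)
    have := Real.exp_pos (-x)
    nlinarith

theorem expCdf_sub_le {x : ℝ} (hx : x ≤ 0) :
    expCdf (x - 6) ≤ 3 / 4 * (Real.exp (-|x|) / 2) := by
  rw [abs_of_nonpos hx, neg_neg, expCdf_of_nonpos (by linarith), Real.exp_sub]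
  have h6 := Real.add_one_le_exp (6 : ℝ)
  have := Real.exp_pos x
  have h1 : Real.exp x / Real.exp 6 ≤ Real.exp x / 7 :=
    div_le_div_of_nonneg_left this.le (by norm_num) (by linarith)
  linarith

theorem continuous_expCdf : Continuous expCdf := by
  unfold expCdf
  refine Continuous.if_le (by fun_prop) (by fun_prop) continuous_id continuous_const ?_
  rintro x rfl
  norm_num

theorem integral_exp_signedLength_le {A : Set ℝ} (hA : MeasurableSet A) {R : ℝ}
    (hR : A ⊆ Icc (-R) R) :
    3 * ∫ y, (Real.exp (1 / 3 * signedLength A y) - 1) ∂expTwoSided ≤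
      ∫ x in A, (1 - expCdf (x - 6) - (Iic (0 : ℝ)).indicator 1 x) := by
  have hP := hA.inter (measurableSet_Ioi (a := (0 : ℝ)))
  have hN := hA.inter (measurableSet_Iic (a := (0 : ℝ)))
  have hPR : A ∩ Ioi 0 ⊆ Icc (-R) R := inter_subset_left.trans hR
  have hNR : A ∩ Iic 0 ⊆ Icc (-R) R := inter_subset_left.trans hR
  have h1 := integral_exp_signedLength_le_of_pos hP hPR inter_subset_right
  have h2 := integral_exp_signedLength_le_of_nonpos hN hNR inter_subset_right
  -- For each `y` at most one of the two signed lengths is nonzero, so the exponentials minus one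
  -- add up exactly.
  have hsum : ∀ y, Real.exp (1 / 3 * signedLength A y) - 1 =
      (Real.exp (1 / 3 * signedLength (A ∩ Ioi 0) y) - 1) +
        (Real.exp (1 / 3 * signedLength (A ∩ Iic 0) y) - 1) := by
    intro y
    have e0 : ∀ B : Set ℝ, ∀ t, (∀ x ∈ uIoc 0 t, x ∉ B) → signedLength B t = 0 := fun B t hB =>
      intervalIntegral.integral_zero_ae (.of_forall fun x hx => indicator_of_notMem (hB x hx) _)
    have e1 : ∀ B : Set ℝ, ∀ t, (∀ x ∈ uIoc 0 t, x ∈ B) →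
        signedLength (A ∩ B) t = signedLength A t := fun B t hB =>
      intervalIntegral.integral_congr_ae (.of_forall fun x hx => by
        by_cases h : x ∈ A <;> simp [h, hB x hx])
    rcases le_total 0 y with h | h
    · rw [e1 (Ioi 0) y fun x hx => by rw [uIoc_of_le h] at hx; exact hx.1,
        e0 (A ∩ Iic 0) y fun x hx H => by
          rw [uIoc_of_le h] at hx; exact absurd hx.1 (not_lt.2 H.2)]
      simp
    · rw [e1 (Iic 0) y fun x hx => by rw [uIoc_of_ge h] at hx; exact hx.2,
        e0 (A ∩ Ioi 0) y fun x hx H => by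
          rw [uIoc_of_ge h] at hx; exact absurd H.2 (not_lt.2 hx.2)]
      simp
  have h0 : ∫ y, (Real.exp (1 / 3 * signedLength A y) - 1) ∂expTwoSided =
      ∫ y, (Real.exp (1 / 3 * signedLength (A ∩ Ioi 0) y) - 1) ∂expTwoSided +
        ∫ y, (Real.exp (1 / 3 * signedLength (A ∩ Iic 0) y) - 1) ∂expTwoSided := by
    simp_rw [hsum]
    exact integral_add ((integrable_exp_signedLength hP hPR _ _).sub (integrable_const _))
      ((integrable_exp_signedLength hN hNR _ _).sub (integrable_const _))
  rw [h0]
  have hvi : IntegrableOn (fun x => 1 - expCdf (x - 6) - (Iic (0 : ℝ)).indicator 1 x)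
      (Icc (-R) R) := by
    refine IntegrableOn.sub ?_ ?_
    · refine Continuous.integrableOn_Icc ?_
      exact continuous_const.sub (continuous_expCdf.comp (by fun_prop))
    · exact (integrableOn_const (C := (1 : ℝ)) (by simp)).indicator measurableSet_Iic
  have hsplit : A = (A ∩ Ioi 0) ∪ (A ∩ Iic 0) := by
    rw [← inter_union_distrib_left, Ioi_union_Iic, inter_univ]
  have hdisj : Disjoint (A ∩ Ioi 0) (A ∩ Iic 0) :=
    disjoint_left.2 fun x hx hx' => absurd (mem_Ioi.1 hx.2) (not_lt.2 hx'.2)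
  have h3 : ∫ x in A, (1 - expCdf (x - 6) - (Iic (0 : ℝ)).indicator 1 x) =
      (∫ x in A ∩ Ioi 0, (1 - expCdf (x - 6) - (Iic (0 : ℝ)).indicator 1 x)) +
        ∫ x in A ∩ Iic 0, (1 - expCdf (x - 6) - (Iic (0 : ℝ)).indicator 1 x) := by
    nth_rewrite 1 [hsplit]
    exact setIntegral_union hdisj hN (hvi.mono_set hPR) (hvi.mono_set hNR)
  have h4 : ∫ x in A ∩ Ioi 0, 3 / 2 * (Real.exp (-|x|) / 2) ≤
      ∫ x in A ∩ Ioi 0, (1 - expCdf (x - 6) - (Iic (0 : ℝ)).indicator 1 x) := by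
    refine setIntegral_mono_on ((integrableOn_exp_neg_abs hPR).const_mul _) (hvi.mono_set hPR) hP fun x hx => ?_
    have := le_one_sub_expCdf hx.2
    rw [indicator_of_notMem (by simpa using hx.2)]
    linarith
  have h5 : ∫ x in A ∩ Iic 0, -(3 / 4) * (Real.exp (-|x|) / 2) ≤
      ∫ x in A ∩ Iic 0, (1 - expCdf (x - 6) - (Iic (0 : ℝ)).indicator 1 x) := by
    refine setIntegral_mono_on ((integrableOn_exp_neg_abs hNR).const_mul _) (hvi.mono_set hNR) hN fun x hx => ?_
    have := expCdf_sub_le hx.2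
    rw [indicator_of_mem hx.2, Pi.one_apply]
    linarith
  rw [integral_const_mul] at h4 h5
  linarith

/-! ### The transport-entropy inequality for the exponential law. -/

/-- Young's inequality for the convex conjugates `klFun` and `exp - 1`; integrated, it yields the
variational bound. -/
theorem mul_le_klFun_add {x g : ℝ} (hx : 0 ≤ x) : x * g ≤ klFun x + (Real.exp g - 1) := by
  rw [klFun_apply]
  rcases hx.eq_or_lt with rfl | hx
  · have := Real.exp_pos g
    simp only [zero_mul, Real.log_zero]
    linarith
  · have h1 := Real.add_one_le_exp (g - Real.log x)
    rw [Real.exp_sub, Real.exp_log hx, le_div_iff₀ hx] at h1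
    nlinarith

/-- A weak form of the variational formula for the relative entropy. -/
theorem integral_sub_integral_exp_le_klDiv {α : Type*} [MeasurableSpace α] {μ ν : Measure α}
    [IsProbabilityMeasure μ] [IsProbabilityMeasure ν] {g : α → ℝ} (hg : Measurable g) {C : ℝ}
    (hC : ∀ x, |g x| ≤ C) (hkl : klDiv ν μ ≠ ∞) :
    ∫ x, g x ∂ν - ∫ x, (Real.exp (g x) - 1) ∂μ ≤ (klDiv ν μ).toReal := by
  obtain ⟨hac, hint⟩ := klDiv_ne_top_iff.1 hkl
  have hgi : Integrable g ν := Integrable.of_bound hg.aestronglyMeasurable C (.of_forall hC)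
  have hexp : Integrable (fun x => Real.exp (g x)) μ :=
    Integrable.of_bound hg.exp.aestronglyMeasurable (Real.exp C) (.of_forall fun x => by
      rw [Real.norm_of_nonneg (Real.exp_pos _).le]
      exact Real.exp_le_exp.2 ((le_abs_self _).trans (hC x)))
  have hexp1 : Integrable (fun x => Real.exp (g x) - 1) μ := hexp.sub (integrable_const 1)
  have hkli := (integrable_klFun_rnDeriv_iff hac).2 hint
  rw [toReal_klDiv_eq_integral_klFun hac, ← integral_rnDeriv_smul hac, sub_le_iff_le_add,
    ← integral_add hkli hexp1]
  refine integral_mono ((integrable_rnDeriv_smul_iff hac).2 hgi) (hkli.add hexp1) fun x => ?_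
  exact mul_le_klFun_add ENNReal.toReal_nonneg

/-- The variational bound is tested on one third of the signed length of the set where the integrand
is positive. Its mean under `ν` gives the tails of `ν`, and its exponential moment is controlled by
the shifted exponential tails; the difference is the integral sought. -/
theorem lintegral_expCdf_sub_le (ν : Measure ℝ) [IsProbabilityMeasure ν] :
    ∫⁻ x, ENNReal.ofReal (expCdf (x - 6) - ν.real (Iio x)) ≤ 3 * klDiv ν expTwoSided := by
  by_cases hkl : klDiv ν expTwoSided = ∞
  · rw [hkl]; simp
  set D : ℝ → ℝ := fun x => expCdf (x - 6) - ν.real (Iio x) with hD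
  have hmono : Monotone fun x => ν.real (Iio x) := fun x y hxy =>
    measureReal_mono (Iio_subset_Iio hxy)
  have hDm : Measurable D :=
    (continuous_expCdf.measurable.comp (measurable_id.sub_const 6)).sub hmono.measurable
  have hs : MeasurableSet {x | 0 < D x} := measurableSet_lt measurable_const hDm
  have key : ∀ n : ℕ, ∫⁻ x in Icc (-(n : ℝ)) n, ENNReal.ofReal (D x) ≤
      3 * klDiv ν expTwoSided := by
    intro n
    -- Cutting to a bounded window makes the test function bounded; the window then exhausts the
    -- line.
    set A : Set ℝ := {x | 0 < D x} ∩ Icc (-(n : ℝ)) n with hAdef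
    have hA : MeasurableSet A := hs.inter measurableSet_Icc
    have hR : A ⊆ Icc (-(n : ℝ)) n := inter_subset_right
    have hfin : volume A ≠ ∞ := ((measure_mono hR).trans_lt (by simp)).ne
    have hbdd : ∀ f : ℝ → ℝ, Measurable f → ∀ C : ℝ, (∀ x, |f x| ≤ C) → IntegrableOn f A :=
      fun f hf C hC => IntegrableOn.of_bound hfin.lt_top hf.aestronglyMeasurable C (.of_forall hC)
    have hind : Measurable ((Iic (0 : ℝ)).indicator (1 : ℝ → ℝ)) :=
      measurable_one.indicator measurableSet_Iic
    have hind1 : ∀ x, |(Iic (0 : ℝ)).indicator (1 : ℝ → ℝ) x| ≤ 1 := fun x => by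
      by_cases h : x ≤ 0 <;> simp [h]
    have hF : IntegrableOn (fun x => 1 - expCdf (x - 6)) A :=
      hbdd _ (measurable_const.sub (continuous_expCdf.measurable.comp (measurable_id.sub_const 6)))
        1 fun x => by
          have := expCdf_pos (x - 6); have := expCdf_lt_one (x - 6)
          rw [abs_of_nonneg] <;> linarith
    have hIci : ∀ x, ν.real (Ici x) = 1 - ν.real (Iio x) := fun x => by
      rw [← compl_Iio, probReal_compl_eq_one_sub measurableSet_Iio]
    have hN : IntegrableOn (fun x => ν.real (Ici x)) A :=
      hbdd _ (by simp_rw [hIci]; exact measurable_const.sub hmono.measurable) 1 fun x => by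
        rw [abs_of_nonneg measureReal_nonneg]; exact measureReal_le_one
    have hDi : IntegrableOn D A := by
      refine (hN.sub hF).congr (.of_forall fun x => ?_)
      simp only [Pi.sub_apply, hIci, hD]; ring
    have h1 : ∫⁻ x in Icc (-(n : ℝ)) n, ENNReal.ofReal (D x) = ENNReal.ofReal (∫ x in A, D x) := by
      rw [ofReal_integral_eq_lintegral_ofReal hDi
        ((ae_restrict_iff' hA).2 (.of_forall fun x hx => hx.1.le)), ← setLIntegral_indicator hs]
      refine lintegral_congr fun x => ?_
      by_cases h : 0 < D x
      · rw [indicator_of_mem (by exact h)]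
      · rw [indicator_of_notMem (by exact h), ENNReal.ofReal_of_nonpos (not_lt.1 h)]
    have hθ : Integrable (A.indicator (1 : ℝ → ℝ)) :=
      (integrable_indicator_iff hA).2 (integrableOn_const (C := (1 : ℝ)) hfin)
    have h2 : ∫ y, signedLength A y ∂ν =
        ∫ x in A, (ν.real (Ici x) - (Iic (0 : ℝ)).indicator 1 x) := by
      unfold signedLength
      rw [integral_primitive hθ, ← integral_indicator hA]
      refine integral_congr_ae (.of_forall fun x => ?_)
      by_cases h : x ∈ A <;> simp [h]
    have h3 : ∫ x in A, D x = (∫ x in A, (ν.real (Ici x) - (Iic (0 : ℝ)).indicator 1 x)) -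
        ∫ x in A, (1 - expCdf (x - 6) - (Iic (0 : ℝ)).indicator 1 x) := by
      have hi := hbdd _ hind 1 hind1
      refine Eq.trans ?_ (integral_sub (hN.sub hi) (hF.sub hi))
      refine integral_congr_ae (.of_forall fun x => ?_)
      simp only [hIci, hD]; ring
    have h4 := integral_exp_signedLength_le hA hR
    have h5 := integral_sub_integral_exp_le_klDiv (g := fun y => 1 / 3 * signedLength A y)
      ((signedLength_lipschitz hA).continuous.measurable.const_mul _)
      (C := 1 / 3 * ∫ x, A.indicator (1 : ℝ → ℝ) x) (fun y => by
        rw [abs_mul, abs_of_pos (by norm_num : (0 : ℝ) < 1 / 3)]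
        exact mul_le_mul_of_nonneg_left (abs_signedLength_le hA hR y) (by norm_num)) hkl
    rw [integral_const_mul, h2] at h5
    rw [h1, ← ENNReal.ofReal_toReal hkl, show (3 : ℝ≥0∞) = ENNReal.ofReal 3 by simp,
      ← ENNReal.ofReal_mul (by norm_num)]
    refine ENNReal.ofReal_le_ofReal ?_
    rw [h3]
    linarith
  have hcover : AECover volume Filter.atTop fun n : ℕ => Icc (-(n : ℝ)) n :=
    aecover_Icc (Filter.tendsto_neg_atTop_atBot.comp tendsto_natCast_atTop_atTop)
      tendsto_natCast_atTop_atTop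
  exact le_of_tendsto' (hcover.lintegral_tendsto_of_countably_generated
    hDm.ennreal_ofReal.aemeasurable) key

/-- Layer cake: the integrand is the length of `[x + 6, R x]`. After exchanging integrals, level `t`
contributes the mass of the `x ≤ t - 6` with `R x ≥ t`. -/
theorem lintegral_monotone_sub_le {R : ℝ → ℝ} (hR : Monotone R) {ν : Measure ℝ}
    [IsProbabilityMeasure ν] (hν : expTwoSided.map R = ν) :
    ∫⁻ x, ENNReal.ofReal (R x - x - 6) ∂expTwoSided ≤ 3 * klDiv ν expTwoSided := by
  refine le_trans ?_ (lintegral_expCdf_sub_le ν)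
  have hS : MeasurableSet {p : ℝ × ℝ | p.1 + 6 ≤ p.2 ∧ p.2 ≤ R p.1} :=
    (measurableSet_le (measurable_fst.add_const 6) measurable_snd).inter
      (measurableSet_le measurable_snd (hR.measurable.comp measurable_fst))
  have h1 : ∀ x, ENNReal.ofReal (R x - x - 6) =
      ∫⁻ t, {p : ℝ × ℝ | p.1 + 6 ≤ p.2 ∧ p.2 ≤ R p.1}.indicator 1 (x, t) := by
    intro x
    have : (fun t => {p : ℝ × ℝ | p.1 + 6 ≤ p.2 ∧ p.2 ≤ R p.1}.indicator (1 : ℝ × ℝ → ℝ≥0∞)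
        (x, t)) = (Icc (x + 6) (R x)).indicator 1 := by
      ext t; simp [indicator]
    rw [this, lintegral_indicator_one measurableSet_Icc, Real.volume_Icc]
    ring_nf
  simp_rw [h1]
  rw [lintegral_lintegral_swap
    (f := fun x t => {p : ℝ × ℝ | p.1 + 6 ≤ p.2 ∧ p.2 ≤ R p.1}.indicator 1 (x, t))
    (measurable_one.indicator hS).aemeasurable]
  refine lintegral_mono fun t => ?_
  have h2 : (fun x => {p : ℝ × ℝ | p.1 + 6 ≤ p.2 ∧ p.2 ≤ R p.1}.indicator (1 : ℝ × ℝ → ℝ≥0∞)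
      (x, t)) = (Iic (t - 6) \ R ⁻¹' Iio t).indicator 1 := by
    ext x; simp [indicator, le_sub_iff_add_le]
  have hm : MeasurableSet (R ⁻¹' Iio t) := hR.measurable measurableSet_Iio
  rw [h2, lintegral_indicator_one (measurableSet_Iic.diff hm)]
  -- Monotonicity of `R` makes the two sets nested, so the mass of their difference is the positive
  -- part of the difference of masses.
  by_cases h : ∃ z, t - 6 ≤ z ∧ R z < t
  · obtain ⟨z, hz, hzt⟩ := h
    have hsub : Iic (t - 6) ⊆ R ⁻¹' Iio t := fun x hx => (hR (le_trans hx hz)).trans_lt hzt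
    rw [sdiff_eq_empty.2 hsub, measure_empty]
    exact zero_le
  · push Not at h
    have hsub : R ⁻¹' Iio t ⊆ Iic (t - 6) := fun x hx => by
      by_contra! H
      exact absurd (h x (not_le.1 H).le) (not_le.2 hx)
    rw [← ofReal_measureReal, measureReal_sdiff hsub hm, expTwoSided_real_Iic, ← hν,
      map_measureReal_apply hR.measurable measurableSet_Iio]

theorem lintegral_monotone_cost_le {R : ℝ → ℝ} (hR : Monotone R) {ν : Measure ℝ}
    [IsProbabilityMeasure ν] (hν : expTwoSided.map R = ν) :
    ∫⁻ x, ENNReal.ofReal ((|x - R x| - 6) / 6) ∂expTwoSided ≤ klDiv ν expTwoSided := by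
  have h1 := lintegral_monotone_sub_le hR hν
  -- Displacements to the left become displacements to the right under reflection, which preserves
  -- the exponential law and does not increase entropy.
  have h2 : ∫⁻ x, ENNReal.ofReal (x - R x - 6) ∂expTwoSided ≤ 3 * klDiv ν expTwoSided := by
    have hR' : Monotone fun x => -R (-x) := fun x y hxy => neg_le_neg (hR (neg_le_neg hxy))
    have : IsProbabilityMeasure (ν.map fun x => -x) :=
      Measure.isProbabilityMeasure_map measurable_neg.aemeasurable
    have hν' : expTwoSided.map (fun x => -R (-x)) = ν.map fun x => -x := by
      rw [← hν, Measure.map_map measurable_neg hR.measurable]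
      nth_rewrite 2 [← expTwoSided_map_neg]
      rw [Measure.map_map (measurable_neg.comp hR.measurable) measurable_neg]
      rfl
    have h3 := lintegral_monotone_sub_le hR' hν'
    have h4 : klDiv (ν.map fun x => -x) expTwoSided ≤ klDiv ν expTwoSided := by
      nth_rewrite 1 [← expTwoSided_map_neg]
      exact klDiv_map_le _ _ measurable_neg
    refine le_trans ?_ (h3.trans (mul_le_mul_right h4 3))
    nth_rewrite 1 [← expTwoSided_map_neg]
    refine (lintegral_map_le _ _).trans (lintegral_mono fun x => ?_)
    rw [show -x - R (-x) - 6 = -R (-x) - x - 6 by ring]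
  have h5 : ∀ x, ENNReal.ofReal ((|x - R x| - 6) / 6) ≤
      ENNReal.ofReal (1 / 6) * (ENNReal.ofReal (R x - x - 6) + ENNReal.ofReal (x - R x - 6)) := by
    intro x
    rw [show (|x - R x| - 6) / 6 = 1 / 6 * (|x - R x| - 6) by ring,
      ENNReal.ofReal_mul (by norm_num)]
    refine mul_le_mul_right ?_ _
    rcases abs_cases (x - R x) with ⟨h, _⟩ | ⟨h, _⟩
    · rw [h]; exact le_add_self
    · rw [h, neg_sub]; exact le_self_add
  refine (lintegral_mono h5).trans ?_
  have hm : Measurable fun x => ENNReal.ofReal (R x - x - 6) :=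
    ((hR.measurable.sub measurable_id).sub_const 6).ennreal_ofReal
  rw [lintegral_const_mul' _ _ ENNReal.ofReal_ne_top, lintegral_add_left hm]
  refine (mul_le_mul_right (add_le_add h1 h2) _).trans (le_of_eq ?_)
  rw [← add_mul, ← mul_assoc, show (3 + 3 : ℝ≥0∞) = ENNReal.ofReal 6 by norm_num,
    ← ENNReal.ofReal_mul (by norm_num)]
  norm_num

/-! ### From contraction of `T` to the transport-entropy inequality. -/

/-- The monotone rearrangement of the two-sided exponential distribution onto `μ`. -/
theorem exists_monotone_map_eq (μ : Measure ℝ) [IsProbabilityMeasure μ] :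
    ∃ T : ℝ → ℝ, Monotone T ∧ (∀ u, transportMap expTwoSided μ u = T u) ∧
      expTwoSided.map T = μ := by
  choose T hT hT' using fun u => exists_quantile_eq μ (expCdf_pos u) (expCdf_lt_one u)
  have hmono : Monotone T := fun u v huv =>
    (hT' u _).2 ((expCdf_strictMono.monotone huv).trans ((hT' v _).1 le_rfl))
  refine ⟨T, hmono, fun u => by rw [transportMap, cdf_expTwoSided, hT], ?_⟩
  have : IsProbabilityMeasure (expTwoSided.map T) :=
    Measure.isProbabilityMeasure_map hmono.measurable.aemeasurable
  refine Measure.ext_of_Iic _ _ fun x => ?_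
  rw [Measure.map_apply hmono.measurable measurableSet_Iic, ← ofReal_cdf μ x]
  have hpre : T ⁻¹' Iic x = {u | expCdf u ≤ cdf μ x} := by
    ext u; exact hT' u x
  rw [hpre]
  rcases (cdf_nonneg μ x).eq_or_lt with h0 | h0
  · rw [← h0, show {u | expCdf u ≤ 0} = ∅ from
      eq_empty_of_forall_notMem fun u hu => absurd hu (not_le.2 (expCdf_pos u))]
    simp
  rcases (cdf_le_one μ x).eq_or_lt with h1 | h1
  · rw [h1, show {u | expCdf u ≤ 1} = univ from
      eq_univ_of_forall fun u => (expCdf_lt_one u).le]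
    simp
  have : {u | expCdf u ≤ cdf μ x} = Iic (expQuantile (cdf μ x)) := by
    ext u
    rw [mem_Iic, ← expCdf_strictMono.le_iff_le, expCdf_expQuantile h0 h1, mem_ofPred_eq]
  rw [this, ← ofReal_measureReal, expTwoSided_real_Iic, expCdf_expQuantile h0 h1]

/-- Lifting a density along a measurable map preserves the relative entropy. -/
theorem exists_map_eq_klDiv_eq {α γ : Type*} [MeasurableSpace α] [MeasurableSpace γ]
    {ρ : Measure α} [IsProbabilityMeasure ρ] {μ ν : Measure γ} [IsProbabilityMeasure μ]
    [IsProbabilityMeasure ν] {T : α → γ} (hT : Measurable T) (hμ : ρ.map T = μ) (hac : ν ≪ μ) :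
    ∃ ν' : Measure α, IsProbabilityMeasure ν' ∧ ν'.map T = ν ∧ klDiv ν' ρ = klDiv ν μ := by
  have hf : Measurable (ν.rnDeriv μ) := Measure.measurable_rnDeriv ν μ
  have hmap : (ρ.withDensity fun x => ν.rnDeriv μ (T x)).map T = ν := by
    ext s hs
    rw [Measure.map_apply hT hs, withDensity_apply _ (hT hs), ← setLIntegral_map hs hf hT, hμ,
      ← withDensity_apply _ hs, Measure.withDensity_rnDeriv_eq _ _ hac]
  have hp : IsProbabilityMeasure (ρ.withDensity fun x => ν.rnDeriv μ (T x)) := by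
    constructor
    rw [← preimage_univ (f := T), ← Measure.map_apply hT MeasurableSet.univ, hmap, measure_univ]
  refine ⟨_, hp, hmap, ?_⟩
  rw [klDiv_eq_lintegral_klFun_of_ac (withDensity_absolutelyContinuous _ _),
    klDiv_eq_lintegral_klFun_of_ac hac]
  have hfm : Measurable fun y => ENNReal.ofReal (klFun (ν.rnDeriv μ y).toReal) :=
    (measurable_klFun.comp hf.ennreal_toReal).ennreal_ofReal
  have h2 : ∫⁻ y, ENNReal.ofReal (klFun (ν.rnDeriv μ y).toReal) ∂μ =
      ∫⁻ y, ENNReal.ofReal (klFun (ν.rnDeriv μ y).toReal) ∂(ρ.map T) := by rw [hμ]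
  rw [h2, lintegral_map hfm hT]
  refine lintegral_congr_ae ?_
  filter_upwards [Measure.rnDeriv_withDensity ρ (hf.comp hT)] with x hx
  simp only [Function.comp_def] at hx
  rw [hx]

/-- Nothing is needed while `s ≤ h`. Otherwise the inverse of `β` at `t` is at least 9 times that at
2, so `t ≥ 9 · 2 = 18`. Then `β s ≤ t / 9` by convexity, and `t / 9 ≤ (t - 6) / 6` exactly when `t ≥
18`. This fixes the constants 9 and 2. -/
theorem IsCost.ofReal_map_rightInv_le (hβ : IsCost β h) {s t : ℝ} (ht : 0 ≤ t) (hs : 0 ≤ s)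
    (hst : s ≤ h / (9 * rightInv β h 2) * rightInv β h t) :
    ENNReal.ofReal (β s) ≤ ENNReal.ofReal ((t - 6) / 6) := by
  have hw := hβ.le_rightInv (y := 2) (by norm_num)
  have hβw := hβ.map_rightInv (y := 2) (by norm_num)
  have hv := hβ.le_rightInv ht
  have hβv := hβ.map_rightInv ht
  set w := rightInv β h 2
  set v := rightInv β h t
  have hh := hβ.pos
  rcases le_or_gt s h with h1 | h1
  · rw [hβ.zero s ⟨hs, h1⟩]; simp
  have hw0 : 0 < w := hh.trans_le hw
  have h2 : 9 * w ≤ v := by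
    have : h < h * v / (9 * w) := by rw [mul_div_right_comm]; linarith
    rw [lt_div_iff₀ (by positivity)] at this
    nlinarith
  have h3 : (18 : ℝ) ≤ t := by
    have h4 := hβ.natCast_mul_le 9 hw0.le
    have h5 := hβ.mono (by positivity) h2
    push_cast at h4
    rw [hβw] at h4
    linarith
  have h6 : h / (9 * w) ≤ 1 / 9 := by
    rw [div_le_div_iff₀ (by positivity) (by norm_num)]; linarith
  have h7 : β s ≤ 1 / 9 * t := by
    refine (hβ.mono hs hst).trans ((hβ.map_mul_le (by positivity) (by linarith)
      (by linarith)).trans ?_)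
    rw [hβv]
    exact mul_le_mul_of_nonneg_right h6 ht
  exact ENNReal.ofReal_le_ofReal (by linarith)

/-- The coupling is the image under `T` of the monotone coupling between the exponential law and a
lift of `ν` with the same entropy. -/
theorem MapContraction.transportEntropy (hβ : IsCost β h) {d : ℝ} (hd : 0 < d) {μ : Measure ℝ}
    [IsProbabilityMeasure μ] (hT : MapContraction β h d μ) :
    TransportEntropy β (d * (h / (9 * rightInv β h 2))) μ := by
  intro ν hν
  by_cases hac : ν ≪ μ
  swap; · rw [klDiv_of_not_ac hac]; exact le_top
  obtain ⟨T, hTm, hTu, hTμ⟩ := exists_monotone_map_eq μ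
  obtain ⟨ν', hν', hmap, hkl⟩ := exists_map_eq_klDiv_eq hTm.measurable hTμ hac
  obtain ⟨R, hRm, -, hRν⟩ := exists_monotone_map_eq ν'
  have hw := hβ.rightInv_pos (y := 2) (by norm_num)
  have hh := hβ.pos
  rw [← hkl]
  refine le_trans ?_ (lintegral_monotone_cost_le hRm hRν)
  have hpair : Measurable fun u => (T u, T (R u)) :=
    hTm.measurable.prodMk (hTm.measurable.comp hRm.measurable)
  have hfst : (expTwoSided.map fun u => (T u, T (R u))).map Prod.fst = μ := by
    rw [Measure.map_map measurable_fst hpair]; exact hTμ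
  have hsnd : (expTwoSided.map fun u => (T u, T (R u))).map Prod.snd = ν := by
    rw [Measure.map_map measurable_snd hpair, ← hmap, ← hRν,
      Measure.map_map hTm.measurable hRm.measurable]
    rfl
  refine iInf_le_of_le _ (iInf_le_of_le hfst (iInf_le_of_le hsnd ?_))
  refine (lintegral_map_le _ _).trans (lintegral_mono fun u => ?_)
  simp only
  rcases eq_or_ne u (R u) with hu | hu
  · rw [← hu, sub_self, abs_zero, mul_zero, hβ.map_zero, ENNReal.ofReal_zero]
    exact zero_le
  have h1 := hT u (R u) hu
  rw [hTu, hTu, ← EReal.coe_sub, EReal.abs_def, ENNReal.ofReal_le_ofReal_iff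
    (mul_nonneg (by positivity) (hβ.rightInv_pos (abs_nonneg _)).le)] at h1
  refine hβ.ofReal_map_rightInv_le (abs_nonneg _) (by positivity) ?_
  calc d * (h / (9 * rightInv β h 2)) * |T u - T (R u)|
      ≤ d * (h / (9 * rightInv β h 2)) * (1 / d * rightInv β h |u - R u|) := by gcongr
    _ = _ := by field_simp

theorem mapContraction_dirac (β : ℝ → ℝ) (h d x : ℝ) :
    MapContraction β h d (Measure.dirac x) := by
  have hq : ∀ u, transportMap expTwoSided (Measure.dirac x) u = x := by
    intro u
    obtain ⟨y, hy, hy'⟩ := exists_quantile_eq (Measure.dirac x) (expCdf_pos u) (expCdf_lt_one u)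
    rw [transportMap, cdf_expTwoSided, hy]
    have h1 : y ≤ x := (hy' x).2 (by
      rw [cdf_eq_real, measureReal_def, Measure.dirac_apply_of_mem (mem_Iic.2 le_rfl)]
      exact (expCdf_lt_one u).le)
    have h2 : x ≤ y := by
      by_contra! H
      have := (hy' y).1 le_rfl
      rw [cdf_eq_real, measureReal_def, Measure.dirac_apply' _ measurableSet_Iic,
        indicator_of_notMem (by simpa using H)] at this
      exact absurd this (not_le.2 (expCdf_pos u))
    rw [le_antisymm h1 h2]
  intro u v _
  rw [hq, hq, ← EReal.coe_sub, sub_self]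
  simp

end TransportLine

theorem theorem2p4 (β : ℝ → ℝ) (h : ℝ) (hh : 0 < h)
    (hconv : ConvexOn ℝ (Set.Ici 0) β)
    (hzero : ∀ t ∈ Set.Icc 0 h, β t = 0)
    (hincr : StrictMonoOn β (Set.Ici h))
    (μ : Measure ℝ) [IsProbabilityMeasure μ] :
    -- the equivalence with explicit constants, when `μ` is not a Dirac mass
    ((¬ ∃ x : ℝ, μ = Measure.dirac x) →
      List.TFAE [
        ∃ a > 0, TransportEntropy β a μ,
        ∃ b > 0, ∃ K : ℝ, 0 < K ∧ max (lowerMoment β μ b) (upperMoment β μ b) ≤ ENNReal.ofReal K,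
        ∃ c > 0, PlanExpansion β c μ,
        ∃ d > 0, MapContraction β h d μ] ∧
      (∀ a > 0, TransportEntropy β a μ →
        max (lowerMoment β μ (a / 2)) (upperMoment β μ (a / 2)) ≤ 3) ∧
      (∀ b > 0, ∀ K : ℝ, 0 < K →
        max (lowerMoment β μ b) (upperMoment β μ b) ≤ ENNReal.ofReal K →
        PlanExpansion β (b * (h / (4 * rightInv β h (Real.log K)))) μ) ∧
      (∀ c > 0, PlanExpansion β c μ → MapContraction β h c μ) ∧
      (∀ d > 0, MapContraction β h d μ →
        TransportEntropy β (d * (h / (9 * rightInv β h 2))) μ)) ∧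
    -- the equivalence of the first and last conditions, with comparable optimal constants
    ((∃ a > 0, TransportEntropy β a μ) ↔ ∃ d > 0, MapContraction β h d μ) ∧
    optContraction β h μ * ENNReal.ofReal (h / (9 * rightInv β h 2)) ≤ optTransport β μ ∧
    optTransport β μ ≤
      optContraction β h μ * ENNReal.ofReal (8 * rightInv β h (Real.log 3) / h) := by
  have hβ : IsCost β h := ⟨hh, hconv, hzero, hincr⟩
  have hw2 := hβ.rightInv_pos (y := 2) (by norm_num)
  have hlog3 : 0 ≤ Real.log 3 := Real.log_nonneg (by norm_num)
  have hw3 := hβ.rightInv_pos hlog3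
  have h12 : ∀ a > 0, TransportEntropy β a μ →
      max (lowerMoment β μ (a / 2)) (upperMoment β μ (a / 2)) ≤ 3 :=
    fun a ha hT => hT.moment_le hβ ha
  have h41 : ∀ d > 0, MapContraction β h d μ →
      TransportEntropy β (d * (h / (9 * rightInv β h 2))) μ :=
    fun d hd hT => hT.transportEntropy hβ hd
  have h34 : ∀ c > 0, PlanExpansion β c μ → MapContraction β h c μ :=
    fun c hc hS => hS.mapContraction hβ hc
  -- The cycle with `K = 3`: the factor 2 of the moment step and the factor 4 of the expansion step
  -- produce the 8 in the bound on the optimal constants.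
  have h14 : (¬ ∃ x : ℝ, μ = Measure.dirac x) → ∀ a > 0, TransportEntropy β a μ →
      MapContraction β h (a / 2 * (h / (4 * rightInv β h (Real.log 3)))) μ := by
    intro hμ a ha hT
    refine h34 _ (by positivity) (planExpansion_of_moment_le hβ (by positivity) (by norm_num) hμ ?_)
    simpa using h12 a ha hT
  refine ⟨fun hμ => ⟨?_, h12, ?_, h34, h41⟩, ⟨?_, ?_⟩, ?_, ?_⟩
  · tfae_have 1 → 2 := by
      rintro ⟨a, ha, hT⟩
      exact ⟨a / 2, by positivity, 3, by norm_num, by simpa using h12 a ha hT⟩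
    tfae_have 2 → 3 := by
      rintro ⟨b, hb, K, hK, hmax⟩
      have hK1 := one_le_of_moment_le hβ hb hK hμ (max_le_iff.1 hmax).1 (max_le_iff.1 hmax).2
      have := hβ.rightInv_pos (Real.log_nonneg hK1)
      exact ⟨_, by positivity, planExpansion_of_moment_le hβ hb hK hμ hmax⟩
    tfae_have 3 → 4 := by
      rintro ⟨c, hc, hS⟩
      exact ⟨c, hc, h34 c hc hS⟩
    tfae_have 4 → 1 := by
      rintro ⟨d, hd, hT⟩
      exact ⟨_, by positivity, h41 d hd hT⟩
    tfae_finish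
  · exact fun b hb K hK hmax => planExpansion_of_moment_le hβ hb hK hμ hmax
  · rintro ⟨a, ha, hT⟩
    by_cases hμ : ∃ x : ℝ, μ = Measure.dirac x
    · obtain ⟨x, rfl⟩ := hμ
      exact ⟨1, one_pos, mapContraction_dirac β h 1 x⟩
    · exact ⟨_, by positivity, h14 hμ a ha hT⟩
  · rintro ⟨d, hd, hT⟩
    exact ⟨_, by positivity, h41 d hd hT⟩
  · simp only [optContraction, ENNReal.iSup_mul]
    refine iSup_le fun d => iSup_le fun hd => iSup_le fun hT => ?_
    rw [← ENNReal.ofReal_mul hd.le]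
    exact le_iSup_of_le _ (le_iSup_of_le (by positivity) (le_iSup_of_le (h41 d hd hT) le_rfl))
  -- For a Dirac mass `T` is constant, so every `d` is admissible and the right-hand side is
  -- infinite.
  · by_cases hμ : ∃ x : ℝ, μ = Measure.dirac x
    · obtain ⟨x, rfl⟩ := hμ
      have htop : optContraction β h (Measure.dirac x) = ∞ := by
        refine ENNReal.eq_top_of_forall_nnreal_le fun r => ?_
        rw [← ENNReal.ofReal_coe_nnreal]
        refine (ENNReal.ofReal_le_ofReal (le_add_of_nonneg_right zero_le_one)).trans ?_
        have hr : (0 : ℝ) < r + 1 := by positivity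
        exact le_iSup_of_le _ (le_iSup_of_le hr
          (le_iSup_of_le (mapContraction_dirac β h _ x) le_rfl))
      rw [htop, ENNReal.top_mul (ENNReal.ofReal_pos.2 (by positivity)).ne']
      exact le_top
    · refine iSup_le fun a => iSup_le fun ha => iSup_le fun hT => ?_
      have hle : ENNReal.ofReal (a / 2 * (h / (4 * rightInv β h (Real.log 3)))) ≤
          optContraction β h μ :=
        le_iSup_of_le _ (le_iSup_of_le (by positivity) (le_iSup_of_le (h14 hμ a ha hT) le_rfl))
      refine le_trans (le_of_eq ?_) (mul_le_mul_left hle _)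
      rw [← ENNReal.ofReal_mul (by positivity)]
      congr 1
      field_simp
      norm_num
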